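/- Let $d\ge 1$ be fixed. Let $S\subset\mathbb{R}^d$ be a set of $n$ points and let $q\in\mathbb{R}^d\setminus S$ be a query point such that $S\cup\{q\}$ is in general position, i.e. any at most $d+1$ points of $S\cup\{q\}$ are affinely independent. Pairwise disjoint sets $S_1,\dots,S_{d+1}$ of $k$ points each are said to $k$-enclose $q$ if $q\in\operatorname{conv}\{p_1,\dots,p_{d+1}\}$ for all $p_1\in S_1,\dots,p_{d+1}\in S_{d+1}$. The enclosing depth $ED(S,q)$ of $q$ with respect to $S$ is the maximum $k\ge 0$ such that there are subsets $S_1,\dots,S_{d+1}$ of $S$ which $k$-enclose $q$. Consider the following algorithm. Let $\mathcal{H}$ be the set of all closed halfspaces whose boundary hyperplane passes through $q$ and $d-1$ points of $S$. For every choice of $d+1$ halfspaces $H_1,\dots,H_{d+1}\in\mathcal{H}$, check whether $\bigcap_i H_i=\{q\}$; if so, count for each $i$ the points of $S$ in $\bigcap_{j\ne i}H_j$ and let $k$ be the smallest of these $d+1$ numbers. Return the largest $k$ obtained over all such choices ($0$ if there is none). Then: 1. $|\mathcal{H}|=2\binom{n}{d-1}$, and the value described above equals $ED(S,q)$: $$\max_{\substack{H_1,\dots,H_{d+1}\in\mathcal{H}\text{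 distinct}\\ \bigcap_i H_i=\{q\}}}\ \min_{1\le i\le d+1}\Bigl|S\cap\bigcap_{j\neq i}H_j\Bigr| = ED(S,q),$$ where the maximum over an empty set of choices is $0$. 2. The algorithm runs in time $O(n^{d^2})$ for fixed $d$. Precisely, implement it on a real RAM (exact real arithmetic; every arithmetic operation, comparison, memory access, assignment, test and loop iteration costs one step) as follows. For each choice of $d-1$ of the $n$ given points, store the two opposite normals, computed as a generalized cross product (by Laplace expansion of determinants), of the hyperplane through $q$ and these points. Then run through all choices of $d+1$ of the stored halfspaces, decide $\bigcap_i H_i=\{q\}$ by checking that the $d+1$ signed maximal minors $(-1)^i\det(a_j)_{j\ne i}$ of the chosen normals $a_1,\dots,a_{d+1}$ are all positive or all negative, and, if this is the case, count by scanning all points of $S$. There is a constant $C$ depending only on $d$ such that, for every input $(S,q)$ as above, this program returns $ED(S,q)$, and if $n\ge 1$ it does so after at most $C\,n^{d^2}$ steps. -/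

import Mathlib

/-! ### Enclosing depth -/

/-- `T 0, …, T d` are `d + 1` pairwise disjoint sets of `k` points each, and `q` lies in the convex
hull of every transversal: the sets `k`-enclose `q`. -/
def KEncloses {d : ℕ} (k : ℕ) (T : Fin (d + 1) → Finset (EuclideanSpace ℝ (Fin d)))
    (q : EuclideanSpace ℝ (Fin d)) : Prop :=
  (∀ i, (T i).card = k) ∧ (∀ i j, i ≠ j → Disjoint (T i) (T j)) ∧
    ∀ p : Fin (d + 1) → EuclideanSpace ℝ (Fin d), (∀ i, p i ∈ T i) →
      q ∈ convexHull ℝ (Set.range p)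

/-- The enclosing depth of `q` with respect to `S`: the maximum `k` such that some subsets
of `S` `k`-enclose `q`. -/
noncomputable def enclosingDepth {d : ℕ} (S : Finset (EuclideanSpace ℝ (Fin d)))
    (q : EuclideanSpace ℝ (Fin d)) : ℕ :=
  sSup {k | ∃ T : Fin (d + 1) → Finset (EuclideanSpace ℝ (Fin d)),
    (∀ i, T i ⊆ S) ∧ KEncloses k T q}

/-- The supremum in the definition of the enclosing depth is a maximum. -/
theorem enclosingDepth_isGreatest {d : ℕ} (S : Finset (EuclideanSpace ℝ (Fin d)))
    (q : EuclideanSpace ℝ (Fin d)) :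
    IsGreatest {k | ∃ T : Fin (d + 1) → Finset (EuclideanSpace ℝ (Fin d)),
      (∀ i, T i ⊆ S) ∧ KEncloses k T q} (enclosingDepth S q) := by
  have hb : BddAbove {k | ∃ T : Fin (d + 1) → Finset (EuclideanSpace ℝ (Fin d)),
      (∀ i, T i ⊆ S) ∧ KEncloses k T q} := by
    refine ⟨S.card, ?_⟩
    rintro k ⟨T, hT, hk, -, -⟩
    rw [← hk 0]
    exact Finset.card_le_card (hT 0)
  refine ⟨Nat.sSup_mem ⟨0, fun _ => ∅, fun _ => Finset.empty_subset _, fun _ => rfl,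
    fun _ _ _ => Finset.disjoint_empty_left _, fun p hp => ?_⟩ hb, fun k hk => le_csSup hb hk⟩
  exact absurd (hp 0) (Finset.notMem_empty _)

/-- The points of `S` together with the further point `q` are in general position: any at most
`d + 1` of them are affinely independent. -/
def InGeneralPosition {d : ℕ} (S : Finset (EuclideanSpace ℝ (Fin d)))
    (q : EuclideanSpace ℝ (Fin d)) : Prop :=
  q ∉ S ∧ ∀ T : Finset (EuclideanSpace ℝ (Fin d)), (T : Set _) ⊆ insert q (S : Set _) →
    T.card ≤ d + 1 → AffineIndependent ℝ (fun x : T => (x : EuclideanSpace ℝ (Fin d)))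

/-! ### The quantity that the algorithm computes -/

/-- The closed halfspaces whose boundary hyperplane passes through `q` and `d - 1` points
of `S`. -/
def candidateHalfspaces {d : ℕ} (S : Finset (EuclideanSpace ℝ (Fin d)))
    (q : EuclideanSpace ℝ (Fin d)) : Set (Set (EuclideanSpace ℝ (Fin d))) :=
  {H | ∃ a : EuclideanSpace ℝ (Fin d), a ≠ 0 ∧
    (∃ B ⊆ S, B.card = d - 1 ∧ ∀ p ∈ B, inner ℝ a (p - q) = 0) ∧
    H = {x | 0 ≤ inner ℝ a (x - q)}}

/-- The maximum, over all choices of `d + 1` candidate halfspaces with intersection `{q}`, of the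
smallest number of points of `S` in the intersection of `d` of them (`0` if there is no such
choice). -/
noncomputable def halfspaceMaxMin {d : ℕ} (S : Finset (EuclideanSpace ℝ (Fin d)))
    (q : EuclideanSpace ℝ (Fin d)) : ℕ :=
  sSup {k | ∃ H : Fin (d + 1) → Set (EuclideanSpace ℝ (Fin d)),
    Function.Injective H ∧ (∀ i, H i ∈ candidateHalfspaces S q) ∧ (⋂ i, H i) = {q} ∧
    k = ⨅ i, ((S : Set (EuclideanSpace ℝ (Fin d))) ∩ ⋂ j ∈ {j | j ≠ i}, H j).ncard}

/-! ### A real RAM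

Structured programs over integer registers (names in `V`) and real arrays (names in `A`), with
exact real arithmetic. Every operation, memory access, assignment, test and loop iteration costs
one step. -/

namespace RealRAM

/-- A memory state: the contents of the registers and of the arrays. -/
structure State (V A : Type) where
  int : V → ℕ
  real : A → ℕ → ℝ

/-- Integer expressions. -/
inductive IExpr (V : Type) : Type
  | lit (c : ℕ)
  | reg (v : V)
  | add (e f : IExpr V)

/-- Real expressions; `cell a e` is the entry of the array `a` at index `e`. -/
inductive RExpr (V A : Type) : Type
  | lit (c : ℤ)
  | cell (a : A) (e : IExpr V)
  | add (e f : RExpr V A)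
  | sub (e f : RExpr V A)
  | mul (e f : RExpr V A)

/-- Tests. -/
inductive Test (V A : Type) : Type
  | triv
  | intLt (e f : IExpr V)
  | realLt (e f : RExpr V A)
  | realLe (e f : RExpr V A)
  | and (s t : Test V A)
  | or (s t : Test V A)

/-- Programs; `loop v lo hi c` executes `c` for `v = lo, lo + 1, …, hi - 1`. -/
inductive Prog (V A : Type) : Type
  | skip
  | setInt (v : V) (e : IExpr V)
  | setReal (a : A) (e : IExpr V) (r : RExpr V A)
  | seq (c c' : Prog V A)
  | ite (t : Test V A) (c c' : Prog V A)
  | loop (v : V) (lo hi : IExpr V) (c : Prog V A)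

section Semantics

variable {V A : Type}

def IExpr.eval (s : State V A) : IExpr V → ℕ
  | .lit c => c
  | .reg v => s.int v
  | .add e f => e.eval s + f.eval s

def IExpr.cost : IExpr V → ℕ
  | .lit _ => 1
  | .reg _ => 1
  | .add e f => e.cost + f.cost + 1

def RExpr.eval (s : State V A) : RExpr V A → ℝ
  | .lit c => (c : ℝ)
  | .cell a e => s.real a (e.eval s)
  | .add e f => e.eval s + f.eval s
  | .sub e f => e.eval s - f.eval s
  | .mul e f => e.eval s * f.eval s

def RExpr.cost : RExpr V A → ℕ
  | .lit _ => 1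
  | .cell _ e => e.cost + 1
  | .add e f => e.cost + f.cost + 1
  | .sub e f => e.cost + f.cost + 1
  | .mul e f => e.cost + f.cost + 1

def Test.Holds (s : State V A) : Test V A → Prop
  | .triv => True
  | .intLt e f => e.eval s < f.eval s
  | .realLt e f => e.eval s < f.eval s
  | .realLe e f => e.eval s ≤ f.eval s
  | .and t u => t.Holds s ∧ u.Holds s
  | .or t u => t.Holds s ∨ u.Holds s

def Test.cost : Test V A → ℕ
  | .triv => 1
  | .intLt e f => e.cost + f.cost + 1
  | .realLt e f => e.cost + f.cost + 1
  | .realLe e f => e.cost + f.cost + 1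
  | .and t u => t.cost + u.cost + 1
  | .or t u => t.cost + u.cost + 1

variable [DecidableEq V] [DecidableEq A]

def State.setInt (s : State V A) (v : V) (x : ℕ) : State V A :=
  { s with int := Function.update s.int v x }

def State.setReal (s : State V A) (a : A) (i : ℕ) (x : ℝ) : State V A :=
  { s with real := Function.update s.real a (Function.update (s.real a) i x) }

/-- `iter f i m s` performs the `m` loop rounds `f i, f (i + 1), …, f (i + m - 1)` from the
state `s`; it yields the final state and the number of steps. -/
def iter (f : ℕ → State V A → State V A × ℕ) : ℕ → ℕ → State V A → State V A × ℕ
  | _, 0, s => (s, 1)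
  | i, m + 1, s =>
    ((iter f (i + 1) m (f i s).1).1, (f i s).2 + 1 + (iter f (i + 1) m (f i s).1).2)

open Classical in
/-- Execution of a program from a state: the final state and the number of steps. -/
noncomputable def Prog.run : Prog V A → State V A → State V A × ℕ
  | .skip, s => (s, 1)
  | .setInt v e, s => (s.setInt v (e.eval s), e.cost + 1)
  | .setReal a e r, s => (s.setReal a (e.eval s) (r.eval s), e.cost + r.cost + 1)
  | .seq c c', s => ((c'.run (c.run s).1).1, (c.run s).2 + (c'.run (c.run s).1).2)
  | .ite t c c', s =>
    if t.Holds s then ((c.run s).1, t.cost + 1 + (c.run s).2)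
    else ((c'.run s).1, t.cost + 1 + (c'.run s).2)
  | .loop v lo hi c, s =>
    ((iter (fun i u => c.run (u.setInt v i)) (lo.eval s) (hi.eval s - lo.eval s) s).1,
      lo.cost + hi.cost +
        (iter (fun i u => c.run (u.setInt v i)) (lo.eval s) (hi.eval s - lo.eval s) s).2)

end Semantics

section Combinators

variable {V A : Type}

def sumExpr (l : List (RExpr V A)) : RExpr V A := l.foldr .add (.lit 0)

def allTests (l : List (Test V A)) : Test V A := l.foldr .and .triv

def seqAll (l : List (Prog V A)) : Prog V A := l.foldr .seq .skip

/-- The determinant of a square matrix of expressions (Laplace expansion along the first row). -/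
def detExpr : (k : ℕ) → (Fin k → Fin k → RExpr V A) → RExpr V A
  | 0, _ => .lit 1
  | k + 1, M => sumExpr (List.ofFn fun j : Fin (k + 1) =>
      .mul (.mul (.lit ((-1) ^ (j : ℕ))) (M 0 j)) (detExpr k fun r c => M r.succ (j.succAbove c)))

/-- `chooseLoop x hi body k j lo` executes `body` for all choices of values
`lo ≤ x j < x (j + 1) < … < x (j + k - 1) < hi`. -/
def chooseLoop (x : ℕ → V) (hi : IExpr V) (body : Prog V A) : ℕ → ℕ → IExpr V → Prog V A
  | 0, _, _ => body
  | k + 1, j, lo =>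
    .loop (x j) lo hi (chooseLoop x hi body k (j + 1) (.add (.reg (x j)) (.lit 1)))

end Combinators

end RealRAM

/-! ### The algorithm as a real RAM program -/

namespace EnclosingDepthProgram

open RealRAM

/-- The integer registers: the number `size` of data points, the number `numH` of halfspaces,
the indices `pidx j` of chosen points and `hidx j` of chosen halfspaces, the index `scan` of the
point that is being tested, a counter, the minimum of the counts, and the output `best`. -/
inductive Reg : Type
  | size
  | numH
  | pidx (j : ℕ)
  | hidx (j : ℕ)
  | scan
  | count
  | least
  | best
  deriving DecidableEq

/-- The real arrays, one for each coordinate `c`: the query point (at index `0`), the data points,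
and the inner normals of the halfspaces. -/
inductive Arr : Type
  | query (c : ℕ)
  | data (c : ℕ)
  | normal (c : ℕ)
  deriving DecidableEq

/-- Coordinate `c` of the vector from the query point to the data point with index `e`. -/
def diffExpr (c : ℕ) (e : IExpr Reg) : RExpr Reg Arr :=
  .sub (.cell (.data c) e) (.cell (.query c) (.lit 0))

/-- Coordinate `c` of the generalized cross product of the vectors from the query point to the
`d - 1` chosen data points. -/
def normalExpr (d c : ℕ) : RExpr Reg Arr :=
  detExpr d fun i j =>
    if (i : ℕ) = 0 then .lit (if (j : ℕ) = c then 1 else 0)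
    else diffExpr j (.reg (.pidx (i - 1)))

/-- Append to the table the two halfspaces bounded by the hyperplane through the query point and
the chosen data points. -/
def addHalfspaces (d : ℕ) : Prog Reg Arr :=
  .seq (seqAll ((List.range d).map fun c =>
      .seq (.setReal (.normal c) (.reg .numH) (normalExpr d c))
        (.setReal (.normal c) (.add (.reg .numH) (.lit 1)) (.sub (.lit 0) (normalExpr d c)))))
    (.setInt .numH (.add (.reg .numH) (.lit 2)))

/-- The signed maximal minor of the `d + 1` chosen normals in which normal `i` is left out: the
coefficient of normal `i` in their linear dependency. -/
def minorExpr (d : ℕ) (i : Fin (d + 1)) : RExpr Reg Arr :=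
  .mul (.lit ((-1) ^ (i : ℕ)))
    (detExpr d fun r c => .cell (.normal c) (.reg (.hidx (i.succAbove r))))

/-- Is the query point the only common point of the `d + 1` chosen halfspaces? This is the case if
and only if the signed minors are all positive or all negative. -/
def pointTest (d : ℕ) : Test Reg Arr :=
  .or (allTests (List.ofFn fun i : Fin (d + 1) => .realLt (.lit 0) (minorExpr d i)))
    (allTests (List.ofFn fun i : Fin (d + 1) => .realLt (minorExpr d i) (.lit 0)))

/-- Does the point with index `scan` lie in the chosen halfspace `j`? -/
def memTest (d j : ℕ) : Test Reg Arr :=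
  .realLe (.lit 0) (sumExpr ((List.range d).map fun c =>
    .mul (.cell (.normal c) (.reg (.hidx j))) (diffExpr c (.reg .scan))))

/-- Count the data points in the intersection of the chosen halfspaces other than `i`, and lower
`least` to this number if it is smaller. -/
def countStep (d i : ℕ) : Prog Reg Arr :=
  .seq (.setInt .count (.lit 0))
    (.seq (.loop .scan (.lit 0) (.reg .size)
        (.ite (allTests (((List.range (d + 1)).filter (fun j => j ≠ i)).map (memTest d)))
          (.setInt .count (.add (.reg .count) (.lit 1))) .skip))
      (.ite (.intLt (.reg .count) (.reg .least)) (.setInt .least (.reg .count)) .skip))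

/-- Treat one choice of `d + 1` halfspaces. -/
def treatChoice (d : ℕ) : Prog Reg Arr :=
  .ite (pointTest d)
    (.seq (.setInt .least (.reg .size))
      (.seq (seqAll ((List.range (d + 1)).map (countStep d)))
        (.ite (.intLt (.reg .best) (.reg .least)) (.setInt .best (.reg .least)) .skip)))
    .skip

/-- The whole algorithm: build the table of halfspaces from all choices of `d - 1` data points,
then treat all choices of `d + 1` halfspaces of the table. The output is in the register `best`. -/
def program (d : ℕ) : Prog Reg Arr :=
  .seq (.setInt .numH (.lit 0))
    (.seq (chooseLoop .pidx (.reg .size) (addHalfspaces d) (d - 1) 0 (.lit 0))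
      (.seq (.setInt .best (.lit 0))
        (chooseLoop .hidx (.reg .numH) (treatChoice d) (d + 1) 0 (.lit 0))))

/-- The memory holds the data points `p 0, …, p (n - 1)`, their number, and the query point `q`
(all else is arbitrary). -/
def HoldsInput {d n : ℕ} (s : State Reg Arr) (p : Fin n → EuclideanSpace ℝ (Fin d))
    (q : EuclideanSpace ℝ (Fin d)) : Prop :=
  s.int .size = n ∧ (∀ c : Fin d, s.real (.query c) 0 = q c) ∧
    ∀ (i : Fin n) (c : Fin d), s.real (.data c) i = p i c

end EnclosingDepthProgram

/-! ### Positive spanning, its dual description, and tight separating functionals -/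

section PositiveSpanning

variable {E : Type*} [NormedAddCommGroup E] [InnerProductSpace ℝ E] {d : ℕ}

/-! Both the geometry and the sign test rest on one notion: `d + 1` vectors in dimension `d` that
span and have a strictly positive linear dependency (`PosSpanning`). Normals have this property
exactly when their halfspaces through `q` meet only in `q` (`iInter_halfspaces_eq_singleton_iff`).
In general position, so do the vectors from `q` to any transversal of enclosing sets
(`InGeneralPosition.posSpanning`).

Halfspaces give enclosing sets (`le_enclosingDepth`). Choose `k` points in each intersection of `d`
halfspaces. If a transversal `p` missed `q` in its hull, some `y` would be positive on all `p i -
q`. But `-y` is a nonnegative combination of the normals that omits some normal `i`, and is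
therefore nonnegative on `p i - q`.

Enclosing sets give halfspaces (`InGeneralPosition.exists_halfspaces`). Positive spanning passes
from transversals to points of the convex hulls, so for each `j` the point `q` is outside the hull
of the sets other than `T j` and can be separated from it. The separating hyperplane is rotated
about `q` until it contains `d - 1` data points (`exists_tight_functional`), staying strictly
positive at a chosen point of `T (j + 1)`. A cyclic argument then shows that the resulting normals
span positively.

For the program, the signed maximal minors are the coefficients of a dependency, so positive
spanning is a sign condition (`posSpanning_iff_signedMinor`), and the cross products supply every
candidate halfspace. Invariants of the nested loops show that every increasing choice is treated and
that no value above the depth is stored. The table has at most `2 * n ^ (d - 1)` entries and each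
choice costs `O(n)`, whence the exponent `1 + (d - 1) * (d + 1) = d ^ 2`. -/

/-- The vectors `x 0, …, x d` span the space and `0` is a combination of them with positive
coefficients. -/
def PosSpanning (x : Fin (d + 1) → E) : Prop :=
  Submodule.span ℝ (Set.range x) = ⊤ ∧ ∃ c : Fin (d + 1) → ℝ, (∀ i, 0 < c i) ∧ ∑ i, c i • x i = 0

/-- Dividing the dependency by its coefficient at `i` puts `x i` in minus the open cone of the other
vectors. In this form the condition is visibly convex in `x i`. -/
theorem posSpanning_iff_succAbove (x : Fin (d + 1) → E) (i : Fin (d + 1)) :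
    PosSpanning x ↔ Submodule.span ℝ (Set.range fun r => x (i.succAbove r)) = ⊤ ∧
      ∃ c : Fin d → ℝ, (∀ r, 0 < c r) ∧ x i + ∑ r, c r • x (i.succAbove r) = 0 := by
  constructor
  · rintro ⟨hs, c, hc, h0⟩
    rw [Fin.sum_univ_succAbove _ i] at h0
    have h1 : x i + ∑ r, ((c i)⁻¹ * c (i.succAbove r)) • x (i.succAbove r) = 0 := by
      have := congrArg (fun y => (c i)⁻¹ • y) h0
      simpa [smul_add, smul_smul, Finset.smul_sum, inv_mul_cancel₀ (hc i).ne'] using this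
    refine ⟨?_, _, fun r => mul_pos (inv_pos.2 (hc i)) (hc _), h1⟩
    rw [eq_top_iff, ← hs, Submodule.span_le]
    rintro _ ⟨l, rfl⟩
    rcases Fin.eq_self_or_eq_succAbove i l with rfl | ⟨r, rfl⟩
    · rw [eq_neg_of_add_eq_zero_left h1]
      exact Submodule.neg_mem _ (Submodule.sum_mem _ fun r _ =>
        Submodule.smul_mem _ _ (Submodule.subset_span ⟨r, rfl⟩))
    · exact Submodule.subset_span ⟨r, rfl⟩
  · rintro ⟨hs, c, hc, h0⟩
    refine ⟨?_, i.insertNth 1 c, ?_, ?_⟩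
    · rw [eq_top_iff, ← hs]
      refine Submodule.span_mono ?_
      rintro _ ⟨r, rfl⟩
      exact ⟨_, rfl⟩
    · intro l
      rcases Fin.eq_self_or_eq_succAbove i l with rfl | ⟨r, rfl⟩
      · simp
      · simpa using hc r
    · rw [Fin.sum_univ_succAbove _ i]
      simpa using h0

theorem PosSpanning.linearIndependent {x : Fin (d + 1) → E} (hx : PosSpanning x)
    (hd : Module.finrank ℝ E = d) (i : Fin (d + 1)) :
    LinearIndependent ℝ fun r => x (i.succAbove r) :=
  linearIndependent_of_top_le_span_of_card_eq_finrank
    ((posSpanning_iff_succAbove x i).1 hx).1.ge (by simp [hd])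

/-- Any `d` of the vectors form a basis, so a dependency that omits one vector is trivial. -/
theorem PosSpanning.eq_zero {x : Fin (d + 1) → E} (hx : PosSpanning x)
    (hd : Module.finrank ℝ E = d) {b : Fin (d + 1) → ℝ} (hb : ∑ i, b i • x i = 0)
    {i : Fin (d + 1)} (hi : b i = 0) (l : Fin (d + 1)) : b l = 0 := by
  rw [Fin.sum_univ_succAbove _ i, hi, zero_smul, zero_add] at hb
  have := Fintype.linearIndependent_iff.1 (hx.linearIndependent hd i) _ hb
  rcases Fin.eq_self_or_eq_succAbove i l with rfl | ⟨r, rfl⟩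
  · exact hi
  · exact this r

/-- Coefficients can be shifted along the positive dependency. Subtracting the smallest ratio `b i /
c i` times it makes all of them nonnegative and one of them zero; this missing index drives both
directions of the main argument. -/
theorem PosSpanning.exists_nonneg {x : Fin (d + 1) → E} (hx : PosSpanning x) (y : E) :
    ∃ m : Fin (d + 1) → ℝ, (∀ i, 0 ≤ m i) ∧ (∃ i, m i = 0) ∧ y = ∑ i, m i • x i := by
  obtain ⟨hs, c, hc, h0⟩ := hx
  obtain ⟨b, hb⟩ := (Submodule.mem_span_range_iff_exists_fun ℝ).1
    (hs ▸ Submodule.mem_top : y ∈ Submodule.span ℝ (Set.range x))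
  obtain ⟨i, hi⟩ := Finite.exists_min fun i => b i / c i
  refine ⟨fun l => b l - b i / c i * c l, fun l => ?_, ⟨i, ?_⟩, ?_⟩
  · have := (le_div_iff₀ (hc l)).1 (hi l)
    linarith
  · field_simp [(hc i).ne']
    ring
  · simp only [sub_smul, Finset.sum_sub_distrib, mul_smul, ← Finset.smul_sum, h0, hb, smul_zero,
      sub_zero]

theorem eq_zero_of_forall_inner_eq_zero {ι : Type*} {a : ι → E} {y : E}
    (hs : Submodule.span ℝ (Set.range a) = ⊤) (h : ∀ i, inner ℝ (a i) y = 0) : y = 0 := by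
  have hy : y ∈ (Submodule.span ℝ (Set.range a))ᗮ := by
    rw [Submodule.mem_orthogonal]
    intro u hu
    induction hu using Submodule.span_induction with
    | mem u hu => obtain ⟨i, rfl⟩ := hu; exact h i
    | zero => simp
    | add u v _ _ hu hv => rw [inner_add_left, hu, hv, add_zero]
    | smul c u _ hu => rw [real_inner_smul_left, hu, mul_zero]
  rwa [hs, Submodule.top_orthogonal_eq_bot, Submodule.mem_bot] at hy

theorem exists_ne_zero_orthogonal [FiniteDimensional ℝ E] {ι : Type*} {a : ι → E}
    (hs : Submodule.span ℝ (Set.range a) ≠ ⊤) : ∃ y : E, y ≠ 0 ∧ ∀ i, inner ℝ (a i) y = 0 := by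
  have : (Submodule.span ℝ (Set.range a))ᗮ ≠ ⊥ := fun h => hs (Submodule.orthogonal_eq_bot_iff.1 h)
  obtain ⟨y, hy, h0⟩ := Submodule.exists_mem_ne_zero_of_ne_bot this
  exact ⟨y, h0, fun i => (Submodule.mem_orthogonal _ _).1 hy _ (Submodule.subset_span ⟨i, rfl⟩)⟩

theorem exists_ne_zero_orthogonal_of_card_lt [FiniteDimensional ℝ E] {ι : Type*} [Fintype ι] (a : ι → E)
    (h : Fintype.card ι < Module.finrank ℝ E) : ∃ y : E, y ≠ 0 ∧ ∀ i, inner ℝ (a i) y = 0 := by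
  refine exists_ne_zero_orthogonal fun hs => ?_
  have := finrank_range_le_card (R := ℝ) a
  rw [Set.finrank, hs, finrank_top] at this
  omega

/-- Pairing the positive dependency with `y` writes `0` as a sum of nonnegative terms, so `y` is
orthogonal to a spanning family. -/
theorem PosSpanning.eq_zero_of_forall_nonneg {a : Fin (d + 1) → E} (ha : PosSpanning a) {y : E}
    (hy : ∀ i, 0 ≤ inner ℝ (a i) y) : y = 0 := by
  obtain ⟨hs, c, hc, h0⟩ := ha
  refine eq_zero_of_forall_inner_eq_zero hs fun i => ?_
  have h1 : ∑ i, c i * inner ℝ (a i) y = 0 := by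
    simp_rw [← real_inner_smul_left, ← sum_inner, h0, inner_zero_left]
  have := (Finset.sum_eq_zero_iff_of_nonneg fun i _ => mul_nonneg (hc i).le (hy i)).1 h1 i
    (Finset.mem_univ i)
  exact (mul_eq_zero.1 this).resolve_left (hc i).ne'

/-- If the dual cone of `d + 1` vectors in dimension `d` is trivial, then they span positively. -/
theorem posSpanning_of_dual_trivial [FiniteDimensional ℝ E] {a : Fin (d + 1) → E} (hd : Module.finrank ℝ E = d)
    (ha : ∀ y : E, (∀ i, 0 ≤ inner ℝ (a i) y) → y = 0) : PosSpanning a := by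
  have hs : Submodule.span ℝ (Set.range a) = ⊤ := by
    by_contra hs
    obtain ⟨y, h0, hy⟩ := exists_ne_zero_orthogonal hs
    exact h0 (ha y fun i => (hy i).ge)
  refine ⟨hs, ?_⟩
  have hdep : ¬ LinearIndependent ℝ a := by
    intro h
    have := h.fintype_card_le_finrank
    simp [hd] at this
  obtain ⟨g, hg, i₀, hi₀⟩ := Fintype.not_linearIndependent_iff.1 hdep
  obtain ⟨c, hc, i, hi⟩ : ∃ c : Fin (d + 1) → ℝ, ∑ i, c i • a i = 0 ∧ ∃ i, 0 < c i := by
    rcases lt_or_gt_of_ne hi₀ with h | h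
    · exact ⟨fun i => - g i, by simpa using hg, i₀, by simpa using h⟩
    · exact ⟨g, hg, i₀, h⟩
  refine ⟨c, fun j => ?_, hc⟩
  -- If `c j ≤ 0 < c i`, choose `y ≠ 0` orthogonal to the other `d - 1` vectors. The dependency then
  -- makes `a i` nonnegative wherever `a j` is, so `y` or `-y` lies in the dual cone.
  by_contra hj
  push Not at hj
  have hij : i ≠ j := by rintro rfl; exact absurd hi hj.not_gt
  have hrel : ∀ y : E, (∀ l, l ≠ i → l ≠ j → inner ℝ (a l) y = 0) →
      c i * inner ℝ (a i) y + c j * inner ℝ (a j) y = 0 := by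
    intro y hy
    have h1 : ∑ l, c l * inner ℝ (a l) y = 0 := by
      simp_rw [← real_inner_smul_left, ← sum_inner, hc, inner_zero_left]
    rwa [Fintype.sum_eq_add i j hij fun l hl => by rw [hy l hl.1 hl.2, mul_zero]] at h1
  obtain ⟨y, hy0, hy⟩ := exists_ne_zero_orthogonal_of_card_lt
    (fun l : {l // l ∈ (Finset.univ.erase i).erase j} => a l) (by
      rw [Fintype.card_coe, Finset.card_erase_of_mem (by simp [hij.symm]),
        Finset.card_erase_of_mem (Finset.mem_univ _), Finset.card_univ, Fintype.card_fin, hd]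
      have : 0 < d := by
        rcases Nat.eq_zero_or_pos d with rfl | h
        · exact absurd (Subsingleton.elim (α := Fin 1) i j) hij
        · exact h
      omega)
  replace hy : ∀ l, l ≠ i → l ≠ j → inner ℝ (a l) y = 0 := fun l h1 h2 =>
    hy ⟨l, by simp [h1, h2]⟩
  have key : ∀ z : E, (∀ l, l ≠ i → l ≠ j → inner ℝ (a l) z = 0) → 0 ≤ inner ℝ (a j) z → z = 0 := by
    intro z hz hjz
    have h2 : 0 ≤ inner ℝ (a i) z := by
      have := hrel z hz
      have h3 : 0 ≤ c i * inner ℝ (a i) z := by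
        have := mul_nonneg (neg_nonneg.2 hj) hjz
        linarith
      exact nonneg_of_mul_nonneg_right h3 hi
    refine ha z fun l => ?_
    by_cases h1 : l = i
    · rwa [h1]
    by_cases h3 : l = j
    · rwa [h3]
    exact (hz l h1 h3).ge
  rcases le_total 0 (inner ℝ (a j) y) with h | h
  · exact hy0 (key y hy h)
  · refine hy0 (neg_eq_zero.1 (key (-y) (fun l h1 h2 => ?_) ?_))
    · rw [inner_neg_right, hy l h1 h2, neg_zero]
    · rw [inner_neg_right]
      linarith

theorem iInter_halfspaces_eq_singleton_iff [FiniteDimensional ℝ E] {a : Fin (d + 1) → E} (hd : Module.finrank ℝ E = d)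
    (q : E) : (⋂ i, {x | 0 ≤ inner ℝ (a i) (x - q)}) = {q} ↔ PosSpanning a := by
  constructor
  · intro h
    refine posSpanning_of_dual_trivial hd fun y hy => ?_
    have : y + q ∈ (⋂ i, {x | 0 ≤ inner ℝ (a i) (x - q)}) := by
      simpa using hy
    rw [h] at this
    simpa using this
  · intro h
    refine Set.eq_singleton_iff_unique_mem.2 ⟨by simp, fun x hx => ?_⟩
    exact sub_eq_zero.1 (h.eq_zero_of_forall_nonneg (by simpa using hx))

theorem exists_inner_pos_of_notMem_convexHull [FiniteDimensional ℝ E] {s : Set E} (hs : s.Finite) {q : E}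
    (hq : q ∉ convexHull ℝ s) : ∃ a : E, ∀ v ∈ s, 0 < inner ℝ a (v - q) := by
  obtain ⟨f, u, h1, h2⟩ := geometric_hahn_banach_point_closed (convex_convexHull ℝ s)
    (hs.isClosed_convexHull ℝ) hq
  refine ⟨(InnerProductSpace.toDual ℝ E).symm f, fun v hv => ?_⟩
  rw [InnerProductSpace.toDual_symm_apply (𝕜 := ℝ), map_sub]
  have := h2 v (subset_convexHull ℝ s hv)
  linarith

/-- If the normals `a j` span positively and `p i` lies in the halfspaces `j ≠ i`, then the
simplex with vertices `p i` contains `q`. -/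
theorem PosSpanning.mem_convexHull [FiniteDimensional ℝ E] {a : Fin (d + 1) → E} (ha : PosSpanning a) {q : E}
    {p : Fin (d + 1) → E} (hp : ∀ i j, j ≠ i → 0 ≤ inner ℝ (a j) (p i - q)) :
    q ∈ convexHull ℝ (Set.range p) := by
  by_contra hq
  obtain ⟨y, hy⟩ := exists_inner_pos_of_notMem_convexHull (Set.finite_range p) hq
  -- The normal with zero coefficient is the only one about which nothing is known at `p i`.
  obtain ⟨m, hm, ⟨i, hi⟩, hsum⟩ := ha.exists_nonneg (-y)
  have h1 := hy (p i) ⟨i, rfl⟩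
  have h2 : 0 ≤ inner ℝ (-y) (p i - q) := by
    rw [hsum, sum_inner]
    refine Finset.sum_nonneg fun j _ => ?_
    rw [real_inner_smul_left]
    by_cases hj : j = i
    · rw [hj, hi, zero_mul]
    · exact mul_nonneg (hm j) (hp i j hj)
  rw [inner_neg_left] at h2
  linarith

/-- A linear functional that is nonnegative on a spanning family and positive at `p` can be chosen
to vanish on all but one of the vectors of a basis. -/
theorem exists_tight_functional [FiniteDimensional ℝ E] {ι : Type*} (V : Finset ι) (w : ι → E) (p : E)
    (hs : Submodule.span ℝ (w '' V) = ⊤) {a₀ : E} (h0 : ∀ v ∈ V, 0 ≤ inner ℝ a₀ (w v))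
    (hp : 0 < inner ℝ a₀ p) :
    ∃ a : E, (∀ v ∈ V, 0 ≤ inner ℝ a (w v)) ∧ 0 < inner ℝ a p ∧
      ∃ B ⊆ V, B.card + 1 = Module.finrank ℝ E ∧ ∀ v ∈ B, inner ℝ a (w v) = 0 := by
  classical
  let tight : E → Finset ι := fun a => V.filter fun v => inner ℝ a (w v) = 0
  let feas : E → Prop := fun a => (∀ v ∈ V, 0 ≤ inner ℝ a (w v)) ∧ 0 < inner ℝ a p
  -- An extremal choice replaces repeated rotation: take a feasible functional with the most tight
  -- vectors.
  obtain ⟨n, hn⟩ : ∃ n, IsGreatest {n | ∃ a, feas a ∧ (tight a).card = n} n := by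
    have hb : BddAbove {n | ∃ a, feas a ∧ (tight a).card = n} :=
      ⟨V.card, by rintro _ ⟨a, -, rfl⟩; exact Finset.card_filter_le _ _⟩
    exact ⟨_, Nat.sSup_mem ⟨_, a₀, ⟨h0, hp⟩, rfl⟩ hb, fun k hk => le_csSup hb hk⟩
  obtain ⟨⟨a, ha, hcard⟩, hmax⟩ := hn
  suffices hspan : Module.finrank ℝ E ≤ (tight a).card + 1 by
    have hpos : 0 < Module.finrank ℝ E := by
      have : Nontrivial E := ⟨p, 0, by rintro rfl; simp at hp⟩
      exact Module.finrank_pos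
    obtain ⟨B, hB, hBc⟩ := Finset.exists_subset_card_eq
      (show Module.finrank ℝ E - 1 ≤ (tight a).card by omega)
    exact ⟨a, ha.1, ha.2, B, hB.trans (Finset.filter_subset _ _), by omega,
      fun v hv => (Finset.mem_filter.1 (hB hv)).2⟩
  by_contra hlt
  push Not at hlt
  -- With too few tight vectors there is a direction that changes neither them nor the value at `p`.
  obtain ⟨b, hb0, hb⟩ := exists_ne_zero_orthogonal_of_card_lt
    (fun o : Option {v // v ∈ tight a} => o.elim p fun v => w v) (by
      rw [Fintype.card_option, Fintype.card_coe]
      exact hlt)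
  have hbp : inner ℝ b p = 0 := by rw [real_inner_comm]; exact hb none
  have hbt : ∀ v ∈ tight a, inner ℝ b (w v) = 0 := fun v hv => by
    rw [real_inner_comm]; exact hb (some ⟨v, hv⟩)
  obtain ⟨v, hv, hbv⟩ : ∃ v ∈ V, inner ℝ b (w v) ≠ 0 := by
    by_contra! hall
    refine hb0 (eq_zero_of_forall_inner_eq_zero (a := fun v : V => w v) ?_ fun v => ?_)
    · rw [← hs]
      congr 1
      ext; simp
    · rw [real_inner_comm]; exact hall v v.2
  obtain ⟨c, hcp, hct, hcv⟩ : ∃ c : E, inner ℝ c p = 0 ∧ (∀ v ∈ tight a, inner ℝ c (w v) = 0) ∧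
      inner ℝ c (w v) < 0 := by
    rcases lt_or_gt_of_ne hbv with h | h
    · exact ⟨b, hbp, hbt, h⟩
    · exact ⟨-b, by rw [inner_neg_left, hbp, neg_zero],
        fun v hv => by rw [inner_neg_left, hbt v hv, neg_zero], by rw [inner_neg_left]; linarith⟩
  obtain ⟨u, hu, hmin⟩ := Finset.exists_min_image (V.filter fun v => inner ℝ c (w v) < 0)
    (fun v => inner ℝ a (w v) / (- inner ℝ c (w v))) ⟨v, Finset.mem_filter.2 ⟨hv, hcv⟩⟩
  obtain ⟨huV, hcu⟩ := Finset.mem_filter.1 hu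
  -- Ratio test: `t` is the largest step along `c` that keeps all values nonnegative, and it makes
  -- `u` tight as well.
  set t := inner ℝ a (w u) / (- inner ℝ c (w u)) with ht
  have ht0 : 0 ≤ t := div_nonneg (ha.1 u huV) (by linarith)
  have hfeas : feas (a + t • c) := by
    refine ⟨fun v hv => ?_, ?_⟩
    · rw [inner_add_left, real_inner_smul_left]
      by_cases h : inner ℝ c (w v) < 0
      · have := hmin v (Finset.mem_filter.2 ⟨hv, h⟩)
        rw [le_div_iff₀ (by linarith)] at this
        linarith
      · have := mul_nonneg ht0 (not_lt.1 h)
        have := ha.1 v hv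
        linarith
    · rw [inner_add_left, real_inner_smul_left, hcp, mul_zero, add_zero]
      exact ha.2
  have hut : u ∉ tight a := fun h => hcu.ne (hct u h)
  have hsub : insert u (tight a) ⊆ tight (a + t • c) := by
    intro v hv
    rcases Finset.mem_insert.1 hv with rfl | hv
    · refine Finset.mem_filter.2 ⟨huV, ?_⟩
      rw [inner_add_left, real_inner_smul_left, ht, div_neg, neg_mul, div_mul_cancel₀ _ hcu.ne,
        add_neg_cancel]
    · have hv' := Finset.mem_filter.1 hv
      refine Finset.mem_filter.2 ⟨hv'.1, ?_⟩
      rw [inner_add_left, real_inner_smul_left, hct v hv, hv'.2, mul_zero, add_zero]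
  have h1 := Finset.card_le_card hsub
  rw [Finset.card_insert_of_notMem hut] at h1
  have h2 : (tight (a + t • c)).card ≤ n := hmax ⟨_, hfeas, rfl⟩
  omega

/-- With the other vectors fixed, the condition says that they span and that `z - q` lies in minus
their open cone; convex combinations of the coefficients preserve this. -/
theorem convex_setOf_posSpanning_update (x : Fin (d + 1) → E) (q : E) (i : Fin (d + 1)) :
    Convex ℝ {z | PosSpanning fun l => Function.update x i z l - q} := by
  have key : ∀ z, (PosSpanning fun l => Function.update x i z l - q) ↔
      Submodule.span ℝ (Set.range fun r => x (i.succAbove r) - q) = ⊤ ∧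
        ∃ c : Fin d → ℝ, (∀ r, 0 < c r) ∧ z - q + ∑ r, c r • (x (i.succAbove r) - q) = 0 := by
    intro z
    rw [posSpanning_iff_succAbove _ i]
    simp
  intro y hy z hz s t hs ht hst
  rw [Set.mem_ofPred_eq, key] at hy hz ⊢
  obtain ⟨hsp, c, hc, h1⟩ := hy
  obtain ⟨-, e, he, h2⟩ := hz
  refine ⟨hsp, fun r => s * c r + t * e r, fun r => ?_, ?_⟩
  · rcases hs.eq_or_lt with rfl | hs
    · simp only [zero_add] at hst
      simpa [hst] using he r
    · exact add_pos_of_pos_of_nonneg (mul_pos hs (hc r)) (mul_nonneg ht (he r).le)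
  · have h3 : q = s • q + t • q := by rw [← add_smul, hst, one_smul]
    have : s • y + t • z - q + ∑ r, (s * c r + t * e r) • (x (i.succAbove r) - q) =
        s • (y - q + ∑ r, c r • (x (i.succAbove r) - q)) +
          t • (z - q + ∑ r, e r • (x (i.succAbove r) - q)) := by
      have h4 : s • y + t • z - q = s • (y - q) + t • (z - q) := by
        nth_rewrite 1 [h3]
        simp only [smul_sub]
        abel
      simp only [h4, add_smul, mul_smul, Finset.sum_add_distrib, Finset.smul_sum, smul_add]
      abel
    rw [this, h1, h2, smul_zero, smul_zero, add_zero]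

/-- Positive spanning extends from all transversals of a family of sets to all transversals of the
convex hulls. -/
theorem posSpanning_of_mem_convexHull {T : Fin (d + 1) → Set E} {q : E}
    (hT : ∀ p : Fin (d + 1) → E, (∀ i, p i ∈ T i) → PosSpanning fun i => p i - q)
    {x : Fin (d + 1) → E} (hx : ∀ i, x i ∈ convexHull ℝ (T i)) : PosSpanning fun i => x i - q := by
  classical
  -- One coordinate at a time: `s` collects the indices already allowed to range over the convex
  -- hull.
  suffices h : ∀ (s : Finset (Fin (d + 1))) (x : Fin (d + 1) → E),
      (∀ i ∈ s, x i ∈ convexHull ℝ (T i)) → (∀ i, i ∉ s → x i ∈ T i) →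
        PosSpanning fun i => x i - q from h Finset.univ x (fun i _ => hx i) (by simp)
  intro s
  induction s using Finset.induction_on with
  | empty => exact fun x _ h => hT x fun i => h i (by simp)
  | insert i s his ih =>
    intro x h1 h2
    have hsub : convexHull ℝ (T i) ⊆ {z | PosSpanning fun l => Function.update x i z l - q} := by
      refine convexHull_min (fun z hz => ih _ (fun l hl => ?_) fun l hl => ?_)
        (convex_setOf_posSpanning_update x q i)
      · rw [Function.update_of_ne (by rintro rfl; exact his hl)]
        exact h1 l (Finset.mem_insert_of_mem hl)
      · by_cases hli : l = i
        · subst hli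
          simpa using hz
        · rw [Function.update_of_ne hli]
          exact h2 l (by simp [hli, hl])
    have := hsub (h1 i (Finset.mem_insert_self _ _))
    simpa using this

end PositiveSpanning

/-! ### From enclosing sets to halfspaces and back -/

section EnclosingDepth

variable {d : ℕ} {S : Finset (EuclideanSpace ℝ (Fin d))} {q : EuclideanSpace ℝ (Fin d)}

theorem InGeneralPosition.linearIndependent (h : InGeneralPosition S q) {m : ℕ} (hm : m ≤ d)
    {p : Fin m → EuclideanSpace ℝ (Fin d)} (hp : Function.Injective p) (hpS : ∀ i, p i ∈ S) :
    LinearIndependent ℝ fun i => p i - q := by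
  classical
  obtain ⟨f, hf⟩ : ∃ f : Fin (m + 1) → EuclideanSpace ℝ (Fin d), f = Fin.cons q p := ⟨_, rfl⟩
  have hfi : Function.Injective f := by
    rw [hf, Fin.cons_injective_iff]
    refine ⟨?_, hp⟩
    rintro ⟨i, rfl⟩
    exact h.1 (hpS i)
  have hT := h.2 (Finset.univ.image f) (by
    intro x hx
    simp only [Finset.coe_image, Finset.coe_univ, Set.image_univ] at hx
    obtain ⟨i, rfl⟩ := hx
    refine Fin.cases ?_ (fun i => ?_) i
    · simp [hf]
    · exact Set.mem_insert_of_mem _ (by simpa [hf] using hpS i))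
    (by rw [Finset.card_image_of_injective _ hfi]; simpa using hm)
  let e : Fin (m + 1) ↪ (Finset.univ.image f : Finset (EuclideanSpace ℝ (Fin d))) :=
    ⟨fun i => ⟨f i, Finset.mem_image_of_mem f (Finset.mem_univ i)⟩, fun i j hij =>
      hfi (Subtype.ext_iff.1 hij)⟩
  have hA : AffineIndependent ℝ f := hT.comp_embedding e
  rw [affineIndependent_iff_linearIndependent_vsub ℝ _ 0] at hA
  have hsucc : Function.Injective
      fun i : Fin m => (⟨i.succ, Fin.succ_ne_zero i⟩ : {x : Fin (m + 1) // x ≠ 0}) :=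
    fun i j hij => Fin.succ_injective _ (Subtype.ext_iff.1 hij)
  simpa [hf, Function.comp_def] using hA.comp _ hsucc

theorem exists_weights_of_mem_convexHull_range {ι : Type*} [Fintype ι]
    {E : Type*} [AddCommGroup E] [Module ℝ E] {q : E} {p : ι → E} (hp : Function.Injective p)
    (hq : q ∈ convexHull ℝ (Set.range p)) :
    ∃ w : ι → ℝ, (∀ i, 0 ≤ w i) ∧ ∑ i, w i = 1 ∧ ∑ i, w i • (p i - q) = 0 := by
  classical
  have : Set.range p = ((Finset.univ.image p : Finset E) : Set E) := by simp
  rw [this, Finset.mem_convexHull'] at hq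
  obtain ⟨w, h0, h1, h2⟩ := hq
  rw [Finset.sum_image hp.injOn] at h1 h2
  refine ⟨fun i => w (p i), fun i => h0 _ (Finset.mem_image_of_mem p (Finset.mem_univ i)), h1, ?_⟩
  simp_rw [smul_sub]
  rw [Finset.sum_sub_distrib, ← Finset.sum_smul, h1, h2, one_smul, sub_self]

theorem KEncloses.injective {k : ℕ} {T : Fin (d + 1) → Finset (EuclideanSpace ℝ (Fin d))}
    (hT : KEncloses k T q) {p : Fin (d + 1) → EuclideanSpace ℝ (Fin d)} (hp : ∀ i, p i ∈ T i) :
    Function.Injective p := by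
  intro i j hij
  by_contra hne
  exact Finset.disjoint_left.1 (hT.2.1 i j hne) (hp i) (hij ▸ hp j)

/-- In general position, the transversals of enclosing sets span positively, seen from `q`. -/
theorem InGeneralPosition.posSpanning (h : InGeneralPosition S q) {k : ℕ}
    {T : Fin (d + 1) → Finset (EuclideanSpace ℝ (Fin d))} (hTS : ∀ i, T i ⊆ S)
    (hT : KEncloses k T q) {p : Fin (d + 1) → EuclideanSpace ℝ (Fin d)} (hp : ∀ i, p i ∈ T i) :
    PosSpanning fun i => p i - q := by
  have hinj := hT.injective hp
  have hind : ∀ i : Fin (d + 1), LinearIndependent ℝ fun r => p (i.succAbove r) - q := fun i =>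
    h.linearIndependent le_rfl (hinj.comp Fin.succAbove_right_injective) fun r => hTS _ (hp _)
  obtain ⟨w, h0, h1, h2⟩ := exists_weights_of_mem_convexHull_range hinj (hT.2.2 p hp)
  -- A vanishing weight would leave a dependency of `d` independent differences; all weights would
  -- be zero, although their sum is `1`.
  refine ⟨?_, w, fun i => (h0 i).lt_of_ne' fun hi => ?_, h2⟩
  · rw [eq_top_iff, ← (hind 0).span_eq_top_of_card_eq_finrank' (by simp)]
    refine Submodule.span_mono ?_
    rintro _ ⟨r, rfl⟩
    exact ⟨_, rfl⟩
  · rw [Fin.sum_univ_succAbove _ i, hi, zero_smul, zero_add] at h2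
    rw [Fin.sum_univ_succAbove _ i, hi, zero_add,
      Finset.sum_eq_zero fun r _ => Fintype.linearIndependent_iff.1 (hind i) _ h2 r] at h1
    exact zero_ne_one h1

/-- A point is outside the convex hull of all but one of the sets, if all transversals of the
sets span positively, seen from this point. -/
theorem notMem_convexHull_biUnion {T : Fin (d + 1) → Finset (EuclideanSpace ℝ (Fin d))}
    (hdisj : ∀ i j, i ≠ j → Disjoint (T i) (T j)) (hne : ∀ i, (T i).Nonempty)
    (hT : ∀ p : Fin (d + 1) → EuclideanSpace ℝ (Fin d), (∀ i, p i ∈ T i) →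
      PosSpanning fun i => p i - q) (j : Fin (d + 1)) [DecidableEq (EuclideanSpace ℝ (Fin d))] :
    q ∉ convexHull ℝ (((Finset.univ.erase j).biUnion T : Finset _) :
      Set (EuclideanSpace ℝ (Fin d))) := by
  intro hq
  obtain ⟨w, h0, h1, h2⟩ := Finset.mem_convexHull'.1 hq
  have hpd : ((Finset.univ.erase j : Finset (Fin (d + 1))) : Set (Fin (d + 1))).PairwiseDisjoint T :=
    fun i _ l _ hil => hdisj i l hil
  have h3 : ∑ v ∈ (Finset.univ.erase j).biUnion T, w v • (v - q) = 0 := by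
    simp_rw [smul_sub]
    rw [Finset.sum_sub_distrib, ← Finset.sum_smul, h1, h2, one_smul, sub_self]
  rw [Finset.sum_biUnion hpd] at h1 h3
  replace h0 : ∀ i, i ≠ j → ∀ v ∈ T i, 0 ≤ w v := fun i hi v hv =>
    h0 v (Finset.mem_biUnion.2 ⟨i, by simpa using hi, hv⟩)
  -- Group the weights by sets: `x` is the centre of mass of `T i`, or any point of `T i` if the
  -- total weight is zero or `i = j`.
  have hx : ∀ i, ∃ x ∈ convexHull ℝ (T i : Set (EuclideanSpace ℝ (Fin d))),
      i ≠ j → (∑ v ∈ T i, w v) • (x - q) = ∑ v ∈ T i, w v • (v - q) := by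
    intro i
    by_cases hi : i ≠ j ∧ 0 < ∑ v ∈ T i, w v
    · refine ⟨(T i).centerMass w id, (T i).centerMass_id_mem_convexHull (h0 i hi.1) hi.2,
        fun _ => ?_⟩
      simp_rw [smul_sub]
      rw [Finset.sum_sub_distrib, ← Finset.sum_smul, Finset.centerMass, smul_smul,
        mul_inv_cancel₀ hi.2.ne', one_smul]
      rfl
    · obtain ⟨x, hx⟩ := hne i
      refine ⟨x, subset_convexHull ℝ _ hx, fun hij => ?_⟩
      have hz : ∑ v ∈ T i, w v = 0 :=
        le_antisymm (not_lt.1 fun h => hi ⟨hij, h⟩) (Finset.sum_nonneg (h0 i hij))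
      rw [hz, zero_smul, Finset.sum_eq_zero fun v hv => ?_]
      rw [(Finset.sum_eq_zero_iff_of_nonneg (h0 i hij)).1 hz v hv, zero_smul]
  choose x hxm hxe using hx
  have hpos := posSpanning_of_mem_convexHull
    (T := fun i => (T i : Set (EuclideanSpace ℝ (Fin d)))) hT hxm
  -- The grouped combination omits index `j`, so all the total weights vanish.
  have hz := hpos.eq_zero (by simp) (b := fun i => if i = j then 0 else ∑ v ∈ T i, w v) (i := j)
    (by
      rw [← h3, ← Finset.add_sum_erase _ _ (Finset.mem_univ j), if_pos rfl, zero_smul, zero_add]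
      refine Finset.sum_congr rfl fun i hi => ?_
      have hi := Finset.ne_of_mem_erase hi
      rw [if_neg hi, hxe i hi])
    (by simp)
  rw [Finset.sum_eq_zero fun i hi => ?_] at h1
  · exact zero_ne_one h1
  · simpa [Finset.ne_of_mem_erase hi] using hz i

open Fin.NatCast in
/-- Sets that enclose `q` lie in the intersections of `d` out of `d + 1` halfspaces that are
bounded by hyperplanes through `q` and `d - 1` of the given points. -/
theorem InGeneralPosition.exists_halfspaces (hd : 1 ≤ d) (h : InGeneralPosition S q) {k : ℕ} (hk : 1 ≤ k)
    {T : Fin (d + 1) → Finset (EuclideanSpace ℝ (Fin d))} (hTS : ∀ i, T i ⊆ S)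
    (hT : KEncloses k T q) :
    ∃ a : Fin (d + 1) → EuclideanSpace ℝ (Fin d), PosSpanning a ∧
      (∀ j, a j ≠ 0 ∧ ∃ B ⊆ S, B.card = d - 1 ∧ ∀ p ∈ B, inner ℝ (a j) (p - q) = 0) ∧
      (∀ i j, j ≠ i → ∀ p ∈ T i, 0 ≤ inner ℝ (a j) (p - q)) ∧
      Function.Injective fun j => {x | 0 ≤ inner ℝ (a j) (x - q)} := by
  classical
  have hne : ∀ i, (T i).Nonempty := fun i => Finset.card_pos.1 (by rw [hT.1 i]; exact hk)
  have hpos := fun p hp => h.posSpanning (p := p) hTS hT hp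
  choose p hp using hne
  have hpp := hpos p hp
  -- Strict positivity at one point of the next set, in cyclic order, prevents the tightened
  -- functionals from degenerating.
  have key : ∀ j, ∃ a : EuclideanSpace ℝ (Fin d),
      (∀ i, i ≠ j → ∀ v ∈ T i, 0 ≤ inner ℝ a (v - q)) ∧
      0 < inner ℝ a (p (j + 1) - q) ∧
      a ≠ 0 ∧ ∃ B ⊆ S, B.card = d - 1 ∧ ∀ p ∈ B, inner ℝ a (p - q) = 0 := by
    intro j
    have hj : j + 1 ≠ j := by
      simp only [ne_eq, add_eq_left, Fin.one_eq_zero_iff]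
      omega
    obtain ⟨a₀, ha₀⟩ := exists_inner_pos_of_notMem_convexHull (Finset.finite_toSet _)
      (notMem_convexHull_biUnion hT.2.1 (fun i => ⟨p i, hp i⟩) hpos j)
    have hV : ∀ i, i ≠ j → ∀ v ∈ T i, v ∈ (Finset.univ.erase j).biUnion T := fun i hi v hv =>
      Finset.mem_biUnion.2 ⟨i, by simpa using hi, hv⟩
    obtain ⟨a, h1, h2, B, hB, hBc, hB0⟩ := exists_tight_functional
      ((Finset.univ.erase j).biUnion T) (fun v => v - q) (p (j + 1) - q) (by
        rw [eq_top_iff, ← ((posSpanning_iff_succAbove _ j).1 hpp).1]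
        refine Submodule.span_mono ?_
        rintro _ ⟨r, rfl⟩
        exact ⟨_, hV _ (Fin.succAbove_ne j r) _ (hp _), rfl⟩)
      (fun v hv => (ha₀ v hv).le) (ha₀ _ (hV _ hj _ (hp _)))
    refine ⟨a, fun i hi v hv => h1 v (hV i hi v hv), h2, ?_, B, fun v hv => ?_, ?_, hB0⟩
    · rintro rfl
      simp at h2
    · obtain ⟨i, -, hi⟩ := Finset.mem_biUnion.1 (hB hv)
      exact hTS i hi
    · rw [finrank_euclideanSpace_fin] at hBc
      omega
  choose a h1 h2 h3 using key
  have hps : PosSpanning a := by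
    refine posSpanning_of_dual_trivial (by simp) fun y hy => ?_
    obtain ⟨m, hm0, hmi, hm⟩ := hpp.exists_nonneg (-y)
    by_cases hall : ∀ i, m i = 0
    · simpa [hall] using hm
    -- Going round the cycle from a zero coefficient, some zero is followed by a nonzero one, unless
    -- all vanish. There `a i` is positive on `-y`, contradicting `hy`.
    obtain ⟨i, hi, hi1⟩ : ∃ i, m i = 0 ∧ m (i + 1) ≠ 0 := by
      by_contra! hc
      obtain ⟨i, hi⟩ := hmi
      have hind : ∀ t : ℕ, m (i + (t : Fin (d + 1))) = 0 := by
        intro t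
        induction t with
        | zero => simpa using hi
        | succ t ih => rw [Nat.cast_succ, ← add_assoc]; exact hc _ ih
      refine hall fun l => ?_
      have := hind (l - i : Fin (d + 1)).val
      rwa [Fin.cast_val_eq_self, add_sub_cancel] at this
    have h4 : 0 < inner ℝ (a i) (-y) := by
      rw [hm, inner_sum]
      refine Finset.sum_pos' (fun l _ => ?_) ⟨i + 1, Finset.mem_univ _, ?_⟩
      · rw [real_inner_smul_right]
        by_cases hl : l = i
        · rw [hl, hi, zero_mul]
        · exact mul_nonneg (hm0 l) (h1 i l hl _ (hp l))
      · rw [real_inner_smul_right]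
        exact mul_pos ((hm0 _).lt_of_ne' hi1) (h2 i)
    rw [inner_neg_right] at h4
    exact absurd (hy i) (by linarith)
  refine ⟨a, hps, h3, fun i j hij v hv => h1 j i hij.symm v hv, fun i j hij => ?_⟩
  by_contra hne
  -- If halfspaces `i` and `j` coincide, `p j` lies in all of them, also in the one it could have
  -- missed, and hence equals `q`.
  have hmem : p j ∈ {x | 0 ≤ inner ℝ (a j) (x - q)} := by
    have : p j ∈ {x | 0 ≤ inner ℝ (a i) (x - q)} := h1 i j (Ne.symm hne) _ (hp j)
    exact (Set.ext_iff.1 hij (p j)).1 this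
  have : p j - q = 0 := hps.eq_zero_of_forall_nonneg fun l => by
    by_cases hl : l = j
    · rw [hl]; exact hmem
    · exact h1 l j (Ne.symm hl) _ (hp j)
  exact h.1 (hTS j (sub_eq_zero.1 this ▸ hp j))

/-- The number of points of `S` in the intersections of `d` out of `d + 1` halfspaces that meet
only in `q` bounds the enclosing depth from below. -/
theorem le_enclosingDepth (hq : q ∉ S) {a : Fin (d + 1) → EuclideanSpace ℝ (Fin d)}
    (ha : PosSpanning a) {k : ℕ}
    (hk : ∀ i, k ≤ (S.filter fun x => ∀ j, j ≠ i → 0 ≤ inner ℝ (a j) (x - q)).card) :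
    k ≤ enclosingDepth S q := by
  choose T hTs hTc using fun i => Finset.exists_subset_card_eq (hk i)
  have hmem : ∀ i, ∀ x ∈ T i, x ∈ S ∧ ∀ j, j ≠ i → 0 ≤ inner ℝ (a j) (x - q) := fun i x hx =>
    Finset.mem_filter.1 (hTs i hx)
  refine (enclosingDepth_isGreatest S q).2 ⟨T, fun i x hx => (hmem i x hx).1, hTc, ?_, ?_⟩
  · intro i j hij
    refine Finset.disjoint_left.2 fun x hi hj => ?_
    -- The two cones omit different indices, so a common point lies in every halfspace.
    have : x - q = 0 := ha.eq_zero_of_forall_nonneg fun l => by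
      by_cases hl : l = i
      · exact (hmem j x hj).2 l (hl ▸ hij)
      · exact (hmem i x hi).2 l hl
    exact hq (sub_eq_zero.1 this ▸ (hmem i x hi).1)
  · exact fun p hp => ha.mem_convexHull fun i j hij => (hmem i _ (hp i)).2 j hij

end EnclosingDepth

/-! ### Counting the candidate halfspaces; the max-min formula -/

section Candidates

/-- The orthogonal complement of a hyperplane is a line. -/
theorem exists_eq_smul_of_orthogonal {E : Type*} [NormedAddCommGroup E] [InnerProductSpace ℝ E]
    [FiniteDimensional ℝ E] {m : ℕ} {x : Fin m → E} (hx : LinearIndependent ℝ x)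
    (hm : Module.finrank ℝ E = m + 1) {a b : E} (ha : a ≠ 0) (hax : ∀ i, inner ℝ a (x i) = 0)
    (hbx : ∀ i, inner ℝ b (x i) = 0) : ∃ c : ℝ, b = c • a := by
  have hmem : ∀ {y : E}, (∀ i, inner ℝ y (x i) = 0) → y ∈ (Submodule.span ℝ (Set.range x))ᗮ := by
    intro y hy
    rw [Submodule.mem_orthogonal']
    intro u hu
    induction hu using Submodule.span_induction with
    | mem u hu => obtain ⟨i, rfl⟩ := hu; exact hy i
    | zero => simp
    | add u v _ _ hu hv => rw [inner_add_right, hu, hv, add_zero]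
    | smul c u _ hu => rw [real_inner_smul_right, hu, mul_zero]
  have h1 := (Submodule.span ℝ (Set.range x)).finrank_add_finrank_orthogonal
  rw [finrank_span_eq_card hx, Fintype.card_fin, hm] at h1
  obtain ⟨c, hc⟩ := (finrank_eq_one_iff_of_nonzero'
    (⟨a, hmem hax⟩ : (Submodule.span ℝ (Set.range x))ᗮ) (by simpa using ha)).1 (Nat.add_left_cancel h1)
    ⟨b, hmem hbx⟩
  exact ⟨c, (Subtype.ext_iff.1 hc).symm⟩

/-- A closed halfspace determines its boundary: there both `y` and `-y` belong to it, up to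
translation by `q`. -/
theorem inner_eq_zero_iff_of_halfspace_eq {E : Type*} [NormedAddCommGroup E]
    [InnerProductSpace ℝ E] {a b q : E}
    (h : {x | 0 ≤ inner ℝ a (x - q)} = {x | 0 ≤ inner ℝ b (x - q)}) (y : E) :
    inner ℝ a y = 0 ↔ inner ℝ b y = 0 := by
  have key : ∀ y : E, 0 ≤ inner ℝ a y ↔ 0 ≤ inner ℝ b y := fun y => by
    simpa using Set.ext_iff.1 h (y + q)
  have h1 := key y
  have h2 := key (-y)
  rw [inner_neg_right, inner_neg_right] at h2
  constructor <;> intro h3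
  · exact le_antisymm (by linarith [h2.1 (by linarith)]) (h1.1 h3.ge)
  · exact le_antisymm (by linarith [h2.2 (by linarith)]) (h1.2 h3.ge)

theorem halfspace_smul_eq {E : Type*} [NormedAddCommGroup E] [InnerProductSpace ℝ E] (a q : E)
    {c : ℝ} (hc : 0 < c) :
    {x | 0 ≤ inner ℝ (c • a) (x - q)} = {x | 0 ≤ inner ℝ a (x - q)} := by
  ext x
  simp [real_inner_smul_left, hc]

/-- A vector that is parallel to `a` has the same halfspace as `a` or as `-a`. -/
theorem halfspace_eq_or_eq_neg {E : Type*} [NormedAddCommGroup E] [InnerProductSpace ℝ E]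
    {a b : E} (hb : b ≠ 0) {c : ℝ} (h : b = c • a) (q : E) :
    {x | 0 ≤ inner ℝ b (x - q)} = {x | 0 ≤ inner ℝ a (x - q)} ∨
      {x | 0 ≤ inner ℝ b (x - q)} = {x | 0 ≤ inner ℝ (-a) (x - q)} := by
  rcases lt_trichotomy c 0 with hc | rfl | hc
  · right
    rw [h, ← halfspace_smul_eq (-a) q (neg_pos.2 hc), smul_neg, neg_smul, neg_neg]
  · simp [h] at hb
  · left
    rw [h, halfspace_smul_eq a q hc]

variable {d : ℕ} {S : Finset (EuclideanSpace ℝ (Fin d))} {q : EuclideanSpace ℝ (Fin d)}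

theorem InGeneralPosition.exists_enumeration (h : InGeneralPosition S q)
    {B : Finset (EuclideanSpace ℝ (Fin d))} (hB : B ⊆ S) {m : ℕ} (hm : m ≤ d) (hBm : B.card = m) :
    ∃ x : Fin m → EuclideanSpace ℝ (Fin d), Set.range x = B ∧
      LinearIndependent ℝ fun i => x i - q := by
  let e := (B.equivFinOfCardEq hBm).symm
  refine ⟨fun i => e i, ?_, h.linearIndependent hm (Subtype.val_injective.comp e.injective)
    fun i => hB (e i).2⟩
  ext y
  exact ⟨by rintro ⟨i, rfl⟩; exact (e i).2, fun hy => ⟨e.symm ⟨y, hy⟩, by simp⟩⟩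

theorem InGeneralPosition.eq_smul_of_orthogonal (h : InGeneralPosition S q) (hd : 1 ≤ d)
    {B : Finset (EuclideanSpace ℝ (Fin d))} (hB : B ⊆ S) (hBc : B.card = d - 1)
    {a b : EuclideanSpace ℝ (Fin d)} (ha : a ≠ 0) (haB : ∀ p ∈ B, inner ℝ a (p - q) = 0)
    (hbB : ∀ p ∈ B, inner ℝ b (p - q) = 0) : ∃ c : ℝ, b = c • a := by
  obtain ⟨x, hx, hind⟩ := h.exists_enumeration hB (Nat.sub_le d 1) hBc
  have hxB : ∀ i, x i ∈ B := fun i => by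
    have : x i ∈ (B : Set (EuclideanSpace ℝ (Fin d))) := hx ▸ ⟨i, rfl⟩
    exact this
  refine exists_eq_smul_of_orthogonal hind ?_ ha (fun i => haB _ (hxB i)) fun i => hbB _ (hxB i)
  rw [finrank_euclideanSpace_fin]
  omega

/-- A further data point on the hyperplane would give `d` independent vectors orthogonal to `a`.
Thus a candidate hyperplane determines its `d - 1` points. -/
theorem InGeneralPosition.mem_of_inner_eq_zero (h : InGeneralPosition S q) (hd : 1 ≤ d)
    {B : Finset (EuclideanSpace ℝ (Fin d))} (hB : B ⊆ S) (hBc : B.card = d - 1)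
    {a : EuclideanSpace ℝ (Fin d)} (ha : a ≠ 0) (haB : ∀ p ∈ B, inner ℝ a (p - q) = 0)
    {p : EuclideanSpace ℝ (Fin d)} (hp : p ∈ S) (hap : inner ℝ a (p - q) = 0) : p ∈ B := by
  classical
  by_contra hpB
  obtain ⟨x, hx, hind⟩ := h.exists_enumeration (Finset.insert_subset hp hB) (le_refl d)
    (by rw [Finset.card_insert_of_notMem hpB, hBc]; omega)
  refine ha (eq_zero_of_forall_inner_eq_zero
    (hind.span_eq_top_of_card_eq_finrank' (by simp)) fun i => ?_)
  have : x i ∈ ((insert p B : Finset _) : Set (EuclideanSpace ℝ (Fin d))) := hx ▸ ⟨i, rfl⟩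
  rw [real_inner_comm]
  rcases Finset.mem_insert.1 this with h1 | h1
  · rw [h1, hap]
  · exact haB _ h1

/-- Candidates correspond bijectively to pairs of a `(d - 1)`-subset `B` and a sign: the normal is
determined by `B` up to a scalar, and the halfspace determines `B`. -/
theorem InGeneralPosition.ncard_candidateHalfspaces (h : InGeneralPosition S q) (hd : 1 ≤ d) :
    (candidateHalfspaces S q).ncard = 2 * S.card.choose (d - 1) := by
  classical
  have hex : ∀ B : Finset (EuclideanSpace ℝ (Fin d)), ∃ a : EuclideanSpace ℝ (Fin d),
      B.card = d - 1 → a ≠ 0 ∧ ∀ p ∈ B, inner ℝ a (p - q) = 0 := by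
    intro B
    by_cases hB : B.card = d - 1
    · obtain ⟨a, h0, ha⟩ := exists_ne_zero_orthogonal_of_card_lt (fun p : B => (p : _) - q) (by
        rw [Fintype.card_coe, hB, finrank_euclideanSpace_fin]
        omega)
      exact ⟨a, fun _ => ⟨h0, fun p hp => by rw [real_inner_comm]; exact ha ⟨p, hp⟩⟩⟩
    · exact ⟨0, fun h => absurd h hB⟩
  choose a ha using hex
  let g : Finset (EuclideanSpace ℝ (Fin d)) × Bool → Set (EuclideanSpace ℝ (Fin d)) := fun u =>
    {x | 0 ≤ inner ℝ (cond u.2 (a u.1) (-a u.1)) (x - q)}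
  have himg : candidateHalfspaces S q =
      g '' ((S.powersetCard (d - 1) ×ˢ (Finset.univ : Finset Bool) : Finset _) : Set _) := by
    ext H
    constructor
    · rintro ⟨b, hb, ⟨B, hB, hBc, hbB⟩, rfl⟩
      obtain ⟨h0, haB⟩ := ha B hBc
      obtain ⟨c, hc⟩ := h.eq_smul_of_orthogonal hd hB hBc h0 haB hbB
      rcases halfspace_eq_or_eq_neg hb hc q with h1 | h1
      · exact ⟨(B, true), by simp [hB, hBc], h1.symm⟩
      · exact ⟨(B, false), by simp [hB, hBc], h1.symm⟩
    · rintro ⟨⟨B, t⟩, hB, rfl⟩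
      obtain ⟨hB, hBc⟩ : B ⊆ S ∧ B.card = d - 1 := by simpa using hB
      obtain ⟨h0, haB⟩ := ha B hBc
      refine ⟨cond t (a B) (-a B), ?_, ⟨B, hB, hBc, fun p hp => ?_⟩, rfl⟩
      · cases t <;> simp [h0]
      · cases t <;> simp [inner_neg_left, haB p hp]
  rw [himg, Set.InjOn.ncard_image, Set.ncard_coe_finset, Finset.card_product,
    Finset.card_powersetCard, Finset.card_univ, Fintype.card_bool, mul_comm]
  rintro ⟨B, t⟩ hB ⟨B', t'⟩ hB' hg
  obtain ⟨hB, hBc⟩ : B ⊆ S ∧ B.card = d - 1 := by simpa using hB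
  obtain ⟨hB', hBc'⟩ : B' ⊆ S ∧ B'.card = d - 1 := by simpa using hB'
  obtain ⟨h0, haB⟩ := ha B hBc
  obtain ⟨h0', haB'⟩ := ha B' hBc'
  have hz : ∀ y, inner ℝ (a B) y = 0 ↔ inner ℝ (a B') y = 0 := by
    intro y
    have := inner_eq_zero_iff_of_halfspace_eq hg y
    cases t <;> cases t' <;> simpa [inner_neg_left] using this
  have hBB : B = B' := by
    refine Finset.eq_of_subset_of_card_le (fun p hp => ?_) (by rw [hBc, hBc'])
    exact h.mem_of_inner_eq_zero hd hB' hBc' h0' haB' (hB hp) ((hz _).1 (haB p hp))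
  subst hBB
  -- The point `a B + q` distinguishes the two sides.
  have h1 := (Set.ext_iff.1 hg (a B + q))
  have htt : t = t' := by
    cases t <;> cases t' <;> simp [g, inner_neg_left] at h1 ⊢ <;> exact absurd h1 h0
  rw [htt]

theorem ncard_inter_biInter_halfspaces (S : Finset (EuclideanSpace ℝ (Fin d)))
    (q : EuclideanSpace ℝ (Fin d)) (a : Fin (d + 1) → EuclideanSpace ℝ (Fin d))
    (i : Fin (d + 1)) :
    ((S : Set (EuclideanSpace ℝ (Fin d))) ∩
        ⋂ j ∈ {j | j ≠ i}, {x | 0 ≤ inner ℝ (a j) (x - q)}).ncard =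
      (S.filter fun x => ∀ j, j ≠ i → 0 ≤ inner ℝ (a j) (x - q)).card := by
  rw [← Set.ncard_coe_finset]
  congr 1
  ext x
  simp

theorem InGeneralPosition.halfspaceMaxMin_eq (h : InGeneralPosition S q) (hd : 1 ≤ d) :
    halfspaceMaxMin S q = enclosingDepth S q := by
  have hle : ∀ k ∈ {k | ∃ H : Fin (d + 1) → Set (EuclideanSpace ℝ (Fin d)),
      Function.Injective H ∧ (∀ i, H i ∈ candidateHalfspaces S q) ∧ (⋂ i, H i) = {q} ∧
      k = ⨅ i, ((S : Set (EuclideanSpace ℝ (Fin d))) ∩ ⋂ j ∈ {j | j ≠ i}, H j).ncard},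
      k ≤ enclosingDepth S q := by
    rintro k ⟨H, -, hH, hHq, rfl⟩
    choose a ha0 haB ha using hH
    obtain rfl : H = fun i => {x | 0 ≤ inner ℝ (a i) (x - q)} := funext ha
    refine le_enclosingDepth h.1 ((iInter_halfspaces_eq_singleton_iff (by simp) q).1 hHq)
      fun i => ?_
    rw [← ncard_inter_biInter_halfspaces]
    exact ciInf_le (OrderBot.bddBelow _) i
  refine le_antisymm (csSup_le' hle) ?_
  -- At depth `0` the enclosing sets are empty and yield no halfspaces.
  rcases Nat.eq_zero_or_pos (enclosingDepth S q) with h0 | h0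
  · rw [h0]
    exact Nat.zero_le _
  obtain ⟨T, hTS, hT⟩ := (enclosingDepth_isGreatest S q).1
  obtain ⟨a, hap, hac, haT, hai⟩ := h.exists_halfspaces hd h0 hTS hT
  refine le_trans ?_ (le_csSup ⟨_, hle⟩ ⟨fun j => {x | 0 ≤ inner ℝ (a j) (x - q)}, hai,
    fun j => ⟨a j, (hac j).1, (hac j).2, rfl⟩,
    (iInter_halfspaces_eq_singleton_iff (by simp) q).2 hap, rfl⟩)
  refine le_ciInf fun i => ?_
  rw [ncard_inter_biInter_halfspaces, ← hT.1 i]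
  exact Finset.card_le_card fun x hx => Finset.mem_filter.2
    ⟨hTS i hx, fun j hj => haT i j hj x hx⟩

end Candidates

/-! ### Invariant and cost rules for real RAM programs -/

namespace RealRAM

section Run

variable {V A : Type}

theorem sumExpr_eval (s : State V A) (l : List (RExpr V A)) :
    (sumExpr l).eval s = (l.map fun e => e.eval s).sum := by
  induction l with
  | nil => simp [sumExpr, RExpr.eval]
  | cons e l ih =>
    rw [List.map_cons, List.sum_cons, ← ih]
    rfl

theorem allTests_holds (s : State V A) (l : List (Test V A)) :
    (allTests l).Holds s ↔ ∀ t ∈ l, t.Holds s := by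
  induction l with
  | nil => simp [allTests, Test.Holds]
  | cons t l ih =>
    rw [List.forall_mem_cons, ← ih]
    rfl

theorem detExpr_eval (s : State V A) (k : ℕ) (M : Fin k → Fin k → RExpr V A) :
    (detExpr k M).eval s = (Matrix.of fun i j => (M i j).eval s).det := by
  induction k with
  | zero => simp [detExpr, RExpr.eval]
  | succ k ih =>
    rw [detExpr, sumExpr_eval, Matrix.det_succ_row_zero, List.map_ofFn, List.sum_ofFn]
    refine Finset.sum_congr rfl fun j _ => ?_
    simp only [Function.comp_apply, RExpr.eval, ih]
    push_cast
    rfl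

@[simp] theorem State.setInt_int_self [DecidableEq V] (s : State V A) (v : V) (x : ℕ) :
    (s.setInt v x).int v = x := by simp [State.setInt]

theorem State.setInt_int_of_ne [DecidableEq V] (s : State V A) {v w : V} (h : w ≠ v) (x : ℕ) :
    (s.setInt v x).int w = s.int w := by simp [State.setInt, h]

@[simp] theorem State.setInt_real [DecidableEq V] (s : State V A) (v : V) (x : ℕ) :
    (s.setInt v x).real = s.real := rfl

@[simp] theorem State.setReal_int [DecidableEq A] (s : State V A) (a : A) (i : ℕ) (x : ℝ) :
    (s.setReal a i x).int = s.int := rfl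

theorem State.setReal_real [DecidableEq A] (s : State V A) (a b : A) (i j : ℕ) (x : ℝ) :
    (s.setReal a i x).real b j = if b = a ∧ j = i then x else s.real b j := by
  by_cases h : b = a
  · subst h
    by_cases hj : j = i
    · subst hj; simp [State.setReal]
    · simp [State.setReal, hj]
  · simp [State.setReal, h]

theorem iter_spec {f : ℕ → State V A → State V A × ℕ} (J : ℕ → State V A → Prop) (K : ℕ)
    (m : ℕ) : ∀ (lo : ℕ) (s : State V A),
    (∀ i u, lo ≤ i → i < lo + m → J i u → J (i + 1) (f i u).1 ∧ (f i u).2 ≤ K) → J lo s →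
      J (lo + m) (iter f lo m s).1 ∧ (iter f lo m s).2 ≤ m * (K + 1) + 1 := by
  induction m with
  | zero => intro lo s _ hs; simpa [iter] using hs
  | succ m ih =>
    intro lo s hstep hs
    obtain ⟨h1, h2⟩ := hstep lo s le_rfl (by omega) hs
    obtain ⟨h3, h4⟩ := ih (lo + 1) (f lo s).1
      (fun i u hi hi' => hstep i u (by omega) (by omega)) h1
    rw [iter]
    refine ⟨by rw [show lo + (m + 1) = lo + 1 + m by omega]; exact h3, ?_⟩
    rw [Nat.succ_mul]
    dsimp only
    omega

variable [DecidableEq V] [DecidableEq A]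

/-- The invariant rule for loops, with a bound for the number of steps. -/
theorem run_loop_spec (J : ℕ → State V A → Prop) (K : ℕ) {v : V} {lo hi : IExpr V} {c : Prog V A}
    {s : State V A}
    (hstep : ∀ i u, lo.eval s ≤ i → i < hi.eval s → J i u →
      J (i + 1) (c.run (u.setInt v i)).1 ∧ (c.run (u.setInt v i)).2 ≤ K)
    (hs : J (lo.eval s) s) :
    J (lo.eval s + (hi.eval s - lo.eval s)) ((Prog.loop v lo hi c).run s).1 ∧
      ((Prog.loop v lo hi c).run s).2 ≤
        lo.cost + hi.cost + ((hi.eval s - lo.eval s) * (K + 1) + 1) := by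
  obtain ⟨h1, h2⟩ := iter_spec (f := fun i u => c.run (u.setInt v i)) J K
    (hi.eval s - lo.eval s) (lo.eval s) s
    (fun i u h1 h2 => hstep i u h1 (by omega)) hs
  exact ⟨h1, Nat.add_le_add_left h2 _⟩

section ChooseLoop

variable {x : ℕ → V} {hi : IExpr V} {body : Prog V A} {N : ℕ}

/-- The invariant rule for nested loops over increasing sequences, with bounds for a measure and
for the number of steps. -/
theorem run_chooseLoop_spec (hx : Function.Injective x) (hhc : hi.cost ≤ 1)
    (P : State V A → Prop) (m : State V A → ℕ) (b K : ℕ)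
    (hset : ∀ s j v, P s → P (s.setInt (x j) v)) (hm : ∀ s j v, m (s.setInt (x j) v) = m s)
    (hhi : ∀ s, P s → hi.eval s = N)
    (hbody : ∀ s, P s → P (body.run s).1 ∧ (∀ j, (body.run s).1.int (x j) = s.int (x j)) ∧
      m (body.run s).1 ≤ m s + b ∧ (body.run s).2 ≤ K) (k : ℕ) :
    ∀ (j : ℕ) (lo : IExpr V) (s : State V A), lo.cost ≤ 3 → P s →
      P ((chooseLoop x hi body k j lo).run s).1 ∧
      (∀ i < j, ((chooseLoop x hi body k j lo).run s).1.int (x i) = s.int (x i)) ∧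
      m ((chooseLoop x hi body k j lo).run s).1 ≤ m s + b * N ^ k ∧
      ((chooseLoop x hi body k j lo).run s).2 ≤ (K + 1) * (2 * N + 6) ^ k := by
  induction k with
  | zero =>
    intro j lo s _ hs
    obtain ⟨h1, h2, h3, h4⟩ := hbody s hs
    exact ⟨h1, fun i _ => h2 i, by simpa [chooseLoop] using h3,
      by simp only [chooseLoop, pow_zero, mul_one]; omega⟩
  | succ k ih =>
    intro j lo s hlo hs
    have hN := hhi s hs
    set B := (K + 1) * (2 * N + 6) ^ k with hB
    have key := run_loop_spec (v := x j) (lo := lo) (hi := hi)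
      (c := chooseLoop x hi body k (j + 1) (.add (.reg (x j)) (.lit 1))) (s := s)
      -- Each completed round adds at most `b * N ^ k` to the measure and leaves the outer indices
      -- alone.
      (fun i u => P u ∧ (∀ i < j, u.int (x i) = s.int (x i)) ∧
        m u ≤ m s + (i - lo.eval s) * (b * N ^ k)) B
      (fun i u hi1 hi2 hu => by
        obtain ⟨h1, h2, h3⟩ := hu
        obtain ⟨g1, g2, g3, g4⟩ := ih (j + 1) (.add (.reg (x j)) (.lit 1)) (u.setInt (x j) i)
          (by simp [IExpr.cost]) (hset u j i h1)
        refine ⟨⟨g1, fun i' hi' => ?_, ?_⟩, g4⟩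
        · rw [g2 i' (by omega), State.setInt_int_of_ne _ (hx.ne hi'.ne), h2 i' hi']
        · rw [hm] at g3
          rw [show i + 1 - lo.eval s = i - lo.eval s + 1 by omega, Nat.succ_mul]
          omega)
      ⟨hs, fun _ _ => rfl, by simp⟩
    obtain ⟨⟨h1, h2, h3⟩, h4⟩ := key
    rw [chooseLoop]
    refine ⟨h1, h2, h3.trans ?_, h4.trans ?_⟩
    · have h5 : (N - lo.eval s) * (b * N ^ k) ≤ N * (b * N ^ k) :=
        Nat.mul_le_mul_right _ (Nat.sub_le _ _)
      rw [hN, Nat.add_sub_cancel_left, show b * N ^ (k + 1) = N * (b * N ^ k) by ring]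
      exact Nat.add_le_add_left h5 _
    · rw [hN]
      have h5 : (N - lo.eval s) * (B + 1) ≤ N * (B + 1) :=
        Nat.mul_le_mul_right _ (Nat.sub_le _ _)
      -- With `1 ≤ B`, the loop overhead of at most `N + 5` fits into the slack of `(2 * N + 6) *
      -- B`.
      have hB1 : 1 ≤ B := by
        rw [hB]
        exact Nat.one_le_iff_ne_zero.2 (by positivity)
      rw [pow_succ, ← mul_assoc, ← hB]
      nlinarith

/-- A property that is stable under the nested loops and established by their body for one
increasing sequence holds in the end. -/
theorem run_chooseLoop_reach (hx : Function.Injective x) (P Q : State V A → Prop)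
    (hset : ∀ s j v, P s → P (s.setInt (x j) v)) (hQset : ∀ s j v, Q s → Q (s.setInt (x j) v))
    (hhi : ∀ s, P s → hi.eval s = N) (hhc : hi.cost ≤ 1)
    (hbody : ∀ s, P s → P (body.run s).1 ∧ (∀ j, (body.run s).1.int (x j) = s.int (x j)))
    (K : ℕ) (hK : ∀ s, P s → (body.run s).2 ≤ K)
    (hQ : ∀ s, P s → Q s → Q (body.run s).1) {f : ℕ → ℕ} {n : ℕ}
    (hf : ∀ i, i + 1 < n → f i < f (i + 1)) (hfN : ∀ i < n, f i < N)
    (hest : ∀ s, P s → (∀ i < n, s.int (x i) = f i) → Q (body.run s).1) (k : ℕ) :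
    ∀ (j : ℕ) (lo : IExpr V) (s : State V A), j + k = n → lo.cost ≤ 3 → P s →
      (∀ i < j, s.int (x i) = f i) → (j < n → lo.eval s ≤ f j) →
      Q ((chooseLoop x hi body k j lo).run s).1 := by
  -- Only preservation is needed here, so the measure is constantly zero; `hstab` carries `Q` along
  -- as well.
  have hinv := run_chooseLoop_spec (N := N) hx hhc P (fun _ => 0) 0 K hset (fun _ _ _ => rfl) hhi
    (fun s hs => ⟨(hbody s hs).1, (hbody s hs).2, le_rfl, hK s hs⟩)
  have hstab := run_chooseLoop_spec (N := N) hx hhc (fun s => P s ∧ Q s) (fun _ => 0) 0 K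
    (fun s j v hs => ⟨hset s j v hs.1, hQset s j v hs.2⟩) (fun _ _ _ => rfl)
    (fun s hs => hhi s hs.1)
    (fun s hs => ⟨⟨(hbody s hs.1).1, hQ s hs.1 hs.2⟩, (hbody s hs.1).2, le_rfl, hK s hs.1⟩)
  induction k with
  | zero =>
    intro j lo s hj _ hs hreg _
    exact hest s hs fun i hi => hreg i (by omega)
  | succ k ih =>
    intro j lo s hj hlo hs hreg hle
    have hN := hhi s hs
    have hlc : (IExpr.add (.reg (x j)) (.lit 1)).cost ≤ 3 := by simp [IExpr.cost]
    have key := run_loop_spec (v := x j) (lo := lo) (hi := hi)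
      (c := chooseLoop x hi body k (j + 1) (.add (.reg (x j)) (.lit 1))) (s := s)
      -- `Q` is claimed only once the counter has passed `f j`: it is established in round `f j` by
      -- the inner loops and preserved in later rounds.
      (fun i u => P u ∧ (∀ i < j, u.int (x i) = f i) ∧ (f j < i → Q u))
      ((K + 1) * (2 * N + 6) ^ k)
      (fun i u hi1 hi2 hu => by
        obtain ⟨h1, h2, h3⟩ := hu
        obtain ⟨g1, g2, -, g4⟩ := hinv k (j + 1) (.add (.reg (x j)) (.lit 1)) (u.setInt (x j) i)
          hlc (hset u j i h1)
        have hlow : ∀ i' < j, (u.setInt (x j) i).int (x i') = f i' := fun i' hi' => by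
          rw [State.setInt_int_of_ne _ (hx.ne hi'.ne), h2 i' hi']
        refine ⟨⟨g1, fun i' hi' => by rw [g2 i' (by omega), hlow i' hi'], fun hlt => ?_⟩, g4⟩
        rcases Nat.lt_succ_iff_lt_or_eq.1 hlt with h | h
        · exact (hstab k (j + 1) _ _ hlc ⟨hset u j i h1, hQset u j i (h3 h)⟩).1.2
        · refine ih (j + 1) _ _ (by omega) hlc (hset u j i h1) (fun i' hi' => ?_) fun hj' => ?_
          · rcases Nat.lt_succ_iff_lt_or_eq.1 hi' with h' | rfl
            · exact hlow i' h'
            · rw [State.setInt_int_self, h]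
          · have := hf j hj'
            simp only [IExpr.eval, State.setInt_int_self]
            omega)
      ⟨hs, hreg, fun h => absurd (hle (by omega)) (by omega)⟩
    refine key.1.2.2 ?_
    have := hfN j (by omega)
    omega

end ChooseLoop

end Run

end RealRAM

/-! ### Signed minors and generalized cross products -/

section Determinants

variable {d : ℕ}

theorem det_ne_zero_iff_linearIndependent (x : Fin d → EuclideanSpace ℝ (Fin d)) :
    (Matrix.of fun r c => x r c).det ≠ 0 ↔ LinearIndependent ℝ x := by
  have h1 := Matrix.linearIndependent_rows_iff_isUnit (A := Matrix.of fun r c => x r c)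
  rw [Matrix.isUnit_iff_isUnit_det, isUnit_iff_ne_zero] at h1
  rw [← h1, ← LinearMap.linearIndependent_iff (WithLp.linearEquiv 2 ℝ (Fin d → ℝ)).toLinearMap
    (LinearEquiv.ker _)]
  rfl

/-- The signed maximal minor of `d + 1` vectors in which vector `i` is left out. -/
noncomputable def signedMinor (a : Fin (d + 1) → EuclideanSpace ℝ (Fin d)) (i : Fin (d + 1)) : ℝ :=
  (-1) ^ (i : ℕ) * (Matrix.of fun r c => a (i.succAbove r) c).det

/-- Coordinate `c` is the expansion, along its first column, of a determinant in which that column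
occurs twice. -/
theorem sum_signedMinor_smul (a : Fin (d + 1) → EuclideanSpace ℝ (Fin d)) :
    ∑ i, signedMinor a i • a i = 0 := by
  ext c
  have h := Matrix.det_succ_column_zero
    (Matrix.of fun (i : Fin (d + 1)) (j : Fin (d + 1)) => (Fin.cons (a i c) (fun k => a i k) : Fin (d + 1) → ℝ) j)
  rw [Matrix.det_zero_of_column_eq (Fin.succ_ne_zero c).symm (by simp)] at h
  simp only [WithLp.ofLp_sum, WithLp.ofLp_smul, Finset.sum_apply, Pi.smul_apply, smul_eq_mul,
    WithLp.ofLp_zero, Pi.zero_apply]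
  rw [h]
  refine Finset.sum_congr rfl fun i _ => ?_
  rw [signedMinor, mul_right_comm]
  rfl

/-- For a positively spanning family all dependencies are proportional, so the minors are a nonzero
multiple of the positive coefficients. Conversely, one nonzero minor gives spanning, and the minors,
up to a common sign, are the required dependency. -/
theorem posSpanning_iff_signedMinor (a : Fin (d + 1) → EuclideanSpace ℝ (Fin d)) :
    PosSpanning a ↔ (∀ i, 0 < signedMinor a i) ∨ ∀ i, signedMinor a i < 0 := by
  have hne : ∀ i, signedMinor a i ≠ 0 ↔ LinearIndependent ℝ fun r => a (i.succAbove r) := fun i => by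
    rw [← det_ne_zero_iff_linearIndependent, signedMinor]
    simp
  have hsum := sum_signedMinor_smul a
  have hspan : signedMinor a 0 ≠ 0 → Submodule.span ℝ (Set.range a) = ⊤ := fun h => by
    rw [eq_top_iff, ← ((hne 0).1 h).span_eq_top_of_card_eq_finrank' (by simp)]
    refine Submodule.span_mono ?_
    rintro _ ⟨r, rfl⟩
    exact ⟨_, rfl⟩
  constructor
  · intro ha
    obtain ⟨-, c, hc, h0⟩ := id ha
    have hprop : ∀ i, signedMinor a i = signedMinor a 0 / c 0 * c i := by
      intro i
      have h1 : ∑ i, (signedMinor a i - signedMinor a 0 / c 0 * c i) • a i = 0 := by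
        simp only [sub_smul, mul_smul, Finset.sum_sub_distrib, ← Finset.smul_sum, h0, hsum,
          smul_zero, sub_zero]
      exact sub_eq_zero.1 (ha.eq_zero (by simp) h1 (i := 0)
        (by rw [div_mul_cancel₀ _ (hc 0).ne', sub_self]) i)
    have h0' : signedMinor a 0 ≠ 0 := (hne 0).2 (ha.linearIndependent (by simp) 0)
    rcases lt_or_gt_of_ne h0' with h | h
    · exact Or.inr fun i => by
        rw [hprop]; exact mul_neg_of_neg_of_pos (div_neg_of_neg_of_pos h (hc 0)) (hc i)
    · exact Or.inl fun i => by
        rw [hprop]; exact mul_pos (div_pos h (hc 0)) (hc i)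
  · rintro (h | h)
    · exact ⟨hspan (h 0).ne', _, h, hsum⟩
    · exact ⟨hspan (h 0).ne, fun i => - signedMinor a i, fun i => neg_pos.2 (h i), by simpa using hsum⟩

/-- The coordinates of the generalized cross product of the first `d - 1` of the vectors `y k`. -/
noncomputable def genCross (d : ℕ) (y : ℕ → ℕ → ℝ) (c : ℕ) : ℝ :=
  (Matrix.of fun i j : Fin d =>
    if (i : ℕ) = 0 then (if (j : ℕ) = c then 1 else 0) else y (i - 1) j).det

theorem genCross_congr {y z : ℕ → ℕ → ℝ} (h : ∀ k < d - 1, ∀ j < d, y k j = z k j) (c : ℕ) :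
    genCross d y c = genCross d z c := by
  unfold genCross
  congr 2
  ext i j
  split_ifs with h0 h1
  · rfl
  · rfl
  · exact h _ (by omega) _ j.2

/-- Each `genCross` coordinate has a unit vector as first row, hence is a cofactor; pairing with `v`
is the expansion along a first row `v`. -/
theorem sum_genCross_mul (m : ℕ) (y : ℕ → ℕ → ℝ) (v : Fin (m + 1) → ℝ) :
    ∑ c : Fin (m + 1), genCross (m + 1) y c * v c =
      (Matrix.of (Fin.cons v fun (k : Fin m) (j : Fin (m + 1)) => y k j)).det := by
  rw [Matrix.det_succ_row_zero]
  refine Finset.sum_congr rfl fun c _ => ?_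
  rw [genCross, Matrix.det_succ_row_zero, Finset.sum_eq_single c]
  · simp only [Matrix.of_apply, Fin.val_zero, if_true, Fin.cons_zero, mul_one]
    rw [mul_right_comm]
    congr 2
  · intro j _ hj
    simp [Fin.val_inj, hj]
  · simp

/-- The inner product with `v` is the determinant with `v` on top of the `x k`: zero for `v = x k`
by a repeated row, nonzero for `v` outside their span. -/
theorem genCross_spec (hd : 1 ≤ d) {x : Fin (d - 1) → EuclideanSpace ℝ (Fin d)}
    (hx : LinearIndependent ℝ x) {y : ℕ → ℕ → ℝ} (hy : ∀ (k : Fin (d - 1)) (j : Fin d), y k j = x k j) :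
    WithLp.toLp 2 (fun c : Fin d => genCross d y c) ≠ 0 ∧
      ∀ k, inner ℝ (WithLp.toLp 2 fun c : Fin d => genCross d y c) (x k) = 0 := by
  obtain ⟨m, rfl⟩ : ∃ m, d = m + 1 := ⟨d - 1, by omega⟩
  change Fin m → _ at x
  have hinner : ∀ v : EuclideanSpace ℝ (Fin (m + 1)),
      inner ℝ (WithLp.toLp 2 fun c : Fin (m + 1) => genCross (m + 1) y c) v =
        (Matrix.of fun r c => (Fin.cons v x : Fin (m + 1) → EuclideanSpace ℝ (Fin (m + 1))) r c).det := by
    intro v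
    rw [PiLp.inner_apply]
    have : ∀ c : Fin (m + 1), inner ℝ (genCross (m + 1) y c) (v c) =
      genCross (m + 1) y c * v c := fun c => by simp [mul_comm]
    simp only [this]
    rw [sum_genCross_mul m y fun c => v c]
    congr 2
    ext r c
    refine Fin.cases ?_ (fun k => ?_) r
    · rfl
    · exact hy k c
  constructor
  · intro h0
    obtain ⟨v, hv⟩ : ∃ v, v ∉ Submodule.span ℝ (Set.range x) := by
      by_contra! h
      have h1 : Submodule.span ℝ (Set.range x) = ⊤ := eq_top_iff.2 fun v _ => h v
      have h2 := finrank_span_eq_card hx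
      rw [h1, finrank_top] at h2
      simp at h2
    have h1 := hinner v
    rw [h0, inner_zero_left] at h1
    exact (det_ne_zero_iff_linearIndependent _).2 (linearIndependent_finCons.2 ⟨hx, hv⟩) h1.symm
  · intro k
    rw [hinner]
    refine Matrix.det_zero_of_row_eq (Fin.succ_ne_zero k).symm ?_
    ext c
    simp

end Determinants

/-! ### Building the table of halfspaces -/

namespace EnclosingDepthProgram

open RealRAM

theorem seqAll_cost_bounded (l : List (Prog Reg Arr))
    (h : ∀ c ∈ l, ∃ K, ∀ s, (c.run s).2 ≤ K) : ∃ K, ∀ s, ((seqAll l).run s).2 ≤ K := by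
  induction l with
  | nil => exact ⟨1, fun s => le_rfl⟩
  | cons c l ih =>
    obtain ⟨K, hK⟩ := h c (by simp)
    obtain ⟨K', hK'⟩ := ih fun c' hc' => h c' (by simp [hc'])
    exact ⟨K + K', fun s => Nat.add_le_add (hK s) (hK' _)⟩

/-- The differences of the chosen data points and the query point. -/
def chosenDiff (R : Arr → ℕ → ℝ) (f : ℕ → ℕ) (k j : ℕ) : ℝ :=
  R (.data j) (f k) - R (.query j) 0

theorem normalExpr_eval (d c : ℕ) (s : State Reg Arr) :
    (normalExpr d c).eval s = genCross d (chosenDiff s.real fun k => s.int (.pidx k)) c := by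
  rw [normalExpr, detExpr_eval, genCross]
  congr 2
  ext i j
  split_ifs with h0 h1
  · simp [RExpr.eval]
  · simp [RExpr.eval]
  · simp [diffExpr, RExpr.eval, IExpr.eval, chosenDiff]

/-- The writes touch neither `numH` nor the input arrays, so every evaluation of a cross product,
including the second one for the opposite normal, uses the original data. -/
theorem run_writeNormals (d : ℕ) (l : List ℕ) : ∀ s s' : State Reg Arr,
    s' = ((seqAll (l.map fun c =>
      .seq (.setReal (.normal c) (.reg .numH) (normalExpr d c))
        (.setReal (.normal c) (.add (.reg .numH) (.lit 1))
          (.sub (.lit 0) (normalExpr d c))))).run s).1 →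
    s'.int = s.int ∧ (∀ c, s'.real (.query c) = s.real (.query c)) ∧
      (∀ c, s'.real (.data c) = s.real (.data c)) ∧
      (∀ c t, t ≠ s.int .numH → t ≠ s.int .numH + 1 → s'.real (.normal c) t = s.real (.normal c) t) ∧
      (∀ c ∉ l, s'.real (.normal c) = s.real (.normal c)) ∧
      ∀ c ∈ l, s'.real (.normal c) (s.int .numH) =
          genCross d (chosenDiff s.real fun k => s.int (.pidx k)) c ∧
        s'.real (.normal c) (s.int .numH + 1) =
          -genCross d (chosenDiff s.real fun k => s.int (.pidx k)) c := by
  induction l with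
  | nil =>
    rintro s _ rfl
    simp
  | cons c₀ l ih =>
    rintro s s' hs'
    set u := (s.setReal (.normal c₀) (s.int .numH) ((normalExpr d c₀).eval s)) with hu
    set w := u.setReal (.normal c₀) (s.int .numH + 1) (0 - (normalExpr d c₀).eval u) with hw
    have hs'' : s' = ((seqAll (l.map fun c =>
      .seq (.setReal (.normal c) (.reg .numH) (normalExpr d c))
        (.setReal (.normal c) (.add (.reg .numH) (.lit 1))
          (.sub (.lit 0) (normalExpr d c))))).run w).1 := by
      rw [hs']
      simp [seqAll, Prog.run, IExpr.eval, RExpr.eval, hw, hu]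
    have hwi : w.int = s.int := rfl
    have hwq : ∀ c, w.real (.query c) = s.real (.query c) := fun c => by
      ext t; simp [hw, hu, State.setReal_real]
    have hwd : ∀ c, w.real (.data c) = s.real (.data c) := fun c => by
      ext t; simp [hw, hu, State.setReal_real]
    have huq : ∀ c, u.real (.query c) = s.real (.query c) := fun c => by
      ext t; simp [hu, State.setReal_real]
    have hud : ∀ c, u.real (.data c) = s.real (.data c) := fun c => by
      ext t; simp [hu, State.setReal_real]
    have hcw : chosenDiff w.real = chosenDiff s.real := by
      ext; simp [chosenDiff, hwq, hwd]
    have hcu : chosenDiff u.real = chosenDiff s.real := by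
      ext; simp [chosenDiff, huq, hud]
    obtain ⟨h1, h2, h3, h4, h5, h6⟩ := ih w s' hs''
    rw [hwi] at h1 h4 h6
    rw [hcw] at h6
    refine ⟨h1, fun c => (h2 c).trans (hwq c), fun c => (h3 c).trans (hwd c),
      fun c t ht ht' => ?_, fun c hc => ?_, fun c hc => ?_⟩
    · rw [h4 c t ht ht', hw, hu]
      simp [State.setReal_real, ht, ht']
    · rw [List.mem_cons, not_or] at hc
      rw [h5 c hc.2]
      ext t
      simp [hw, hu, State.setReal_real, hc.1]
    · by_cases hcl : c ∈ l
      · exact h6 c hcl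
      · obtain rfl : c = c₀ := (List.mem_cons.1 hc).resolve_right hcl
        rw [h5 c hcl]
        constructor
        · simp [hw, hu, State.setReal_real, normalExpr_eval]
        · rw [hw, State.setReal_real, if_pos ⟨rfl, rfl⟩, normalExpr_eval, hcu, zero_sub]
          rfl

theorem addHalfspaces_cost_bounded (d : ℕ) : ∃ K, ∀ s, ((addHalfspaces d).run s).2 ≤ K := by
  obtain ⟨K, hK⟩ := seqAll_cost_bounded ((List.range d).map fun c =>
      .seq (.setReal (.normal c) (.reg .numH) (normalExpr d c))
        (.setReal (.normal c) (.add (.reg .numH) (.lit 1)) (.sub (.lit 0) (normalExpr d c)))) (by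
    intro c hc
    obtain ⟨i, -, rfl⟩ := List.mem_map.1 hc
    exact ⟨_, fun s => by simp only [Prog.run]; exact le_rfl⟩)
  exact ⟨K + 4, fun s => Nat.add_le_add_right (hK s) 4⟩

theorem run_addHalfspaces (d : ℕ) (s : State Reg Arr) :
    (∀ v, v ≠ .numH → ((addHalfspaces d).run s).1.int v = s.int v) ∧
    ((addHalfspaces d).run s).1.int .numH = s.int .numH + 2 ∧
    (∀ c, ((addHalfspaces d).run s).1.real (.query c) = s.real (.query c)) ∧
    (∀ c, ((addHalfspaces d).run s).1.real (.data c) = s.real (.data c)) ∧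
    (∀ c, ∀ t < s.int .numH,
      ((addHalfspaces d).run s).1.real (.normal c) t = s.real (.normal c) t) ∧
    ∀ c < d, ((addHalfspaces d).run s).1.real (.normal c) (s.int .numH) =
        genCross d (chosenDiff s.real fun k => s.int (.pidx k)) c ∧
      ((addHalfspaces d).run s).1.real (.normal c) (s.int .numH + 1) =
        -genCross d (chosenDiff s.real fun k => s.int (.pidx k)) c := by
  obtain ⟨h1, h2, h3, h4, -, h6⟩ := run_writeNormals d (List.range d) s _ rfl
  refine ⟨fun v hv => ?_, ?_, h2, h3, fun c t ht => h4 c t (by omega) (by omega),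
    fun c hc => h6 c (List.mem_range.2 hc)⟩
  · simp [addHalfspaces, Prog.run, State.setInt, hv, h1]
  · simp [addHalfspaces, Prog.run, State.setInt, IExpr.eval, h1]

/-- The table of halfspaces contains the given vector. -/
def InTable (d : ℕ) (s : State Reg Arr) (w : ℕ → ℝ) : Prop :=
  ∃ t < s.int .numH, ∀ c < d, s.real (.normal c) t = w c

/-- The first part of the program builds the table of all halfspaces. -/
theorem run_buildTable (d : ℕ) : ∃ K : ℕ, ∀ (s s' : State Reg Arr), s.int .numH = 0 →
    s' = ((chooseLoop .pidx (.reg .size) (addHalfspaces d) (d - 1) 0 (.lit 0)).run s).1 →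
    s'.int .size = s.int .size ∧ (∀ c, s'.real (.query c) = s.real (.query c)) ∧
    (∀ c, s'.real (.data c) = s.real (.data c)) ∧
    s'.int .numH ≤ 2 * s.int .size ^ (d - 1) ∧
    (∀ f : ℕ → ℕ, (∀ i, i + 1 < d - 1 → f i < f (i + 1)) → (∀ i < d - 1, f i < s.int .size) →
      InTable d s' (genCross d (chosenDiff s.real f)) ∧
      InTable d s' fun c => -genCross d (chosenDiff s.real f) c) ∧
    ((chooseLoop .pidx (.reg .size) (addHalfspaces d) (d - 1) 0 (.lit 0)).run s).2 ≤
      (K + 1) * (2 * s.int .size + 6) ^ (d - 1) := by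
  obtain ⟨K, hK⟩ := addHalfspaces_cost_bounded d
  refine ⟨K, fun s s' h0 hs' => ?_⟩
  let P : State Reg Arr → Prop := fun u => u.int .size = s.int .size ∧
    (∀ c, u.real (.query c) = s.real (.query c)) ∧ ∀ c, u.real (.data c) = s.real (.data c)
  have hx : Function.Injective Reg.pidx := fun i j h => by injection h
  have hset : ∀ (u : State Reg Arr) j v, P u → P (u.setInt (.pidx j) v) := fun u j v h => h
  have hhi : ∀ u, P u → (IExpr.reg Reg.size).eval u = s.int .size := fun u hu => hu.1
  have hbodyP : ∀ u, P u → P ((addHalfspaces d).run u).1 := fun u h => by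
    obtain ⟨g1, -, g3, g4, -⟩ := run_addHalfspaces d u
    exact ⟨(g1 _ (by simp)).trans h.1, fun c => (g3 c).trans (h.2.1 c),
      fun c => (g4 c).trans (h.2.2 c)⟩
  have hbodyx : ∀ u j, ((addHalfspaces d).run u).1.int (.pidx j) = u.int (.pidx j) := fun u j =>
    (run_addHalfspaces d u).1 _ (by simp)
  obtain ⟨h1, -, h3, h4⟩ := run_chooseLoop_spec (N := s.int .size) (hi := .reg .size)
    (body := addHalfspaces d) hx le_rfl P (fun u => u.int .numH) 2 K hset (fun u j v => rfl)
    hhi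
    (fun u hu => ⟨hbodyP u hu, hbodyx u, (run_addHalfspaces d u).2.1.le, hK u⟩) (d - 1) 0 (.lit 0) s
    (by simp [IExpr.cost]) ⟨rfl, fun _ => rfl, fun _ => rfl⟩
  rw [← hs'] at h1 h3
  rw [h0, zero_add] at h3
  refine ⟨h1.1, h1.2.1, h1.2.2, h3, fun f hf hfN => ?_, h4⟩
  rw [hs']
  -- New entries go to positions from `numH` on, so old entries are never overwritten.
  have hstab : ∀ (w : ℕ → ℝ) (u : State Reg Arr), InTable d u w →
      InTable d ((addHalfspaces d).run u).1 w := by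
    rintro w u ⟨t, ht, hw⟩
    obtain ⟨-, g2, -, -, g5, -⟩ := run_addHalfspaces d u
    exact ⟨t, by omega, fun c hc => (g5 c t ht).trans (hw c hc)⟩
  refine run_chooseLoop_reach (N := s.int .size) hx P (fun u =>
      InTable d u (genCross d (chosenDiff s.real f)) ∧
      InTable d u fun c => -genCross d (chosenDiff s.real f) c) hset
    (fun u j v h => h) hhi le_rfl (fun u hu => ⟨hbodyP u hu, hbodyx u⟩) K
    (fun u _ => hK u) (fun u _ h => ⟨hstab _ u h.1, hstab _ u h.2⟩) hf hfN (fun u hu hreg => ?_)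
    (d - 1) 0 (.lit 0) s (zero_add _) (by simp [IExpr.cost]) ⟨rfl, fun _ => rfl, fun _ => rfl⟩
    (by simp) (fun _ => Nat.zero_le _)
  obtain ⟨-, g2, -, -, -, g6⟩ := run_addHalfspaces d u
  have hcong : ∀ c, genCross d (chosenDiff u.real fun k => u.int (.pidx k)) c =
      genCross d (chosenDiff s.real f) c := genCross_congr fun k hk j _ => by
    rw [chosenDiff, chosenDiff, hu.2.1, hu.2.2, hreg k hk]
  exact ⟨⟨u.int .numH, by omega, fun c hc => (g6 c hc).1.trans (hcong c)⟩,
    ⟨u.int .numH + 1, by omega, fun c hc => (g6 c hc).2.trans (by rw [hcong])⟩⟩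

end EnclosingDepthProgram

/-! ### Counting points and treating all choices of halfspaces -/

namespace EnclosingDepthProgram

open RealRAM

/-- The point with index `t` lies in the halfspace with index `h j` of the table. -/
def InHalfspace (d : ℕ) (R : Arr → ℕ → ℝ) (h : ℕ → ℕ) (j t : ℕ) : Prop :=
  0 ≤ ∑ c ∈ Finset.range d, R (.normal c) (h j) * (R (.data c) t - R (.query c) 0)

theorem memTest_holds (d j : ℕ) (u : State Reg Arr) :
    (memTest d j).Holds u ↔ InHalfspace d u.real (fun j => u.int (.hidx j)) j (u.int .scan) := by
  rw [memTest, Test.Holds, sumExpr_eval, List.map_map, InHalfspace]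
  simp only [RExpr.eval, Int.cast_zero]
  rfl

open Classical in
/-- The number of points that lie in the chosen halfspaces other than number `i`. -/
noncomputable def pointCount (d : ℕ) (R : Arr → ℕ → ℝ) (h : ℕ → ℕ) (n i : ℕ) : ℕ :=
  ((Finset.range n).filter fun t => ∀ j < d + 1, j ≠ i → InHalfspace d R h j t).card

theorem pointCount_le (d : ℕ) (R : Arr → ℕ → ℝ) (h : ℕ → ℕ) (n i : ℕ) : pointCount d R h n i ≤ n := by
  classical exact (Finset.card_filter_le _ _).trans (Finset.card_range n).le

theorem pointCount_succ (d : ℕ) (R : Arr → ℕ → ℝ) (h : ℕ → ℕ) (n i : ℕ) :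
    ((∀ j < d + 1, j ≠ i → InHalfspace d R h j n) →
      pointCount d R h (n + 1) i = pointCount d R h n i + 1) ∧
    (¬ (∀ j < d + 1, j ≠ i → InHalfspace d R h j n) →
      pointCount d R h (n + 1) i = pointCount d R h n i) := by
  classical
  constructor <;> intro hn <;> rw [pointCount, pointCount, Finset.range_add_one, Finset.filter_insert]
  · rw [if_pos hn, Finset.card_insert_of_notMem (by simp)]
  · rw [if_neg hn]

/-- The body of the loop that counts the points. -/
def scanBody (d i : ℕ) : Prog Reg Arr :=
  .ite (allTests (((List.range (d + 1)).filter (fun j => j ≠ i)).map (memTest d)))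
    (.setInt .count (.add (.reg .count) (.lit 1))) .skip

theorem run_scanBody (d i : ℕ) (u : State Reg Arr) :
    ((scanBody d i).run u).1.real = u.real ∧
    (∀ v, v ≠ .count → ((scanBody d i).run u).1.int v = u.int v) ∧
    ((∀ j < d + 1, j ≠ i → InHalfspace d u.real (fun j => u.int (.hidx j)) j (u.int .scan)) →
      ((scanBody d i).run u).1.int .count = u.int .count + 1) ∧
    (¬ (∀ j < d + 1, j ≠ i → InHalfspace d u.real (fun j => u.int (.hidx j)) j (u.int .scan)) →
      ((scanBody d i).run u).1.int .count = u.int .count) ∧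
    ((scanBody d i).run u).2 ≤
      (allTests (((List.range (d + 1)).filter (fun j => j ≠ i)).map
        (memTest d) : List (Test Reg Arr))).cost + 5 := by
  have ht : (allTests (((List.range (d + 1)).filter (fun j => j ≠ i)).map (memTest d))).Holds u ↔
      ∀ j < d + 1, j ≠ i → InHalfspace d u.real (fun j => u.int (.hidx j)) j (u.int .scan) := by
    rw [allTests_holds]
    constructor
    · intro h j hj hji
      exact (memTest_holds d j u).1 (h _ (List.mem_map.2
        ⟨j, List.mem_filter.2 ⟨List.mem_range.2 hj, by simpa using hji⟩, rfl⟩))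
    · intro h t ht
      obtain ⟨j, hj, rfl⟩ := List.mem_map.1 ht
      obtain ⟨hj, hji⟩ := List.mem_filter.1 hj
      exact (memTest_holds d j u).2 (h j (List.mem_range.1 hj) (by simpa using hji))
  rw [scanBody, Prog.run]
  by_cases h : ∀ j < d + 1, j ≠ i → InHalfspace d u.real (fun j => u.int (.hidx j)) j (u.int .scan)
  · rw [if_pos (ht.2 h)]
    refine ⟨rfl, fun v hv => ?_, fun _ => ?_, fun h' => absurd h h', ?_⟩
    · simp [Prog.run, State.setInt_int_of_ne _ hv]
    · simp [Prog.run, IExpr.eval]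
    · simp [Prog.run, IExpr.cost]
  · rw [if_neg (mt ht.1 h)]
    exact ⟨rfl, fun _ _ => rfl, fun h' => absurd h' h, fun _ => rfl, by simp [Prog.run]⟩

theorem run_countStep (d i : ℕ) : ∃ K : ℕ, ∀ u : State Reg Arr,
    ((countStep d i).run u).1.real = u.real ∧
    (∀ v, v ≠ .scan → v ≠ .count → v ≠ .least → ((countStep d i).run u).1.int v = u.int v) ∧
    ((countStep d i).run u).1.int .least = min (u.int .least)
      (pointCount d u.real (fun j => u.int (.hidx j)) (u.int .size) i) ∧
    ((countStep d i).run u).2 ≤ K * (u.int .size + 1) := by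
  set Kt := (allTests (((List.range (d + 1)).filter (fun j => j ≠ i)).map
        (memTest d) : List (Test Reg Arr))).cost with hKt
  refine ⟨Kt + 20, fun u => ?_⟩
  have hloop := run_loop_spec (v := Reg.scan) (lo := .lit 0) (hi := .reg .size) (c := scanBody d i)
    (s := u.setInt .count 0) (fun t w => w.real = u.real ∧
      (∀ v, v ≠ .scan → v ≠ .count → w.int v = u.int v) ∧
      w.int .count = pointCount d u.real (fun j => u.int (.hidx j)) t i) (Kt + 5)
    (fun t w _ _ hw => by
      obtain ⟨h1, h2, h3⟩ := hw
      obtain ⟨g1, g2, g3, g4, g5⟩ := run_scanBody d i (w.setInt .scan t)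
      have hreg : (fun j => (w.setInt .scan t).int (.hidx j)) = fun j => u.int (.hidx j) := by
        ext j
        rw [State.setInt_int_of_ne _ (by simp), h2 _ (by simp) (by simp)]
      rw [hreg, State.setInt_int_self, State.setInt_real, h1,
        State.setInt_int_of_ne _ (by simp), h3] at g3 g4
      refine ⟨⟨g1.trans h1, fun v hv hv' => ?_, ?_⟩, g5⟩
      · rw [g2 v hv', State.setInt_int_of_ne _ hv, h2 v hv hv']
      · by_cases h : ∀ j < d + 1, j ≠ i → InHalfspace d u.real (fun j => u.int (.hidx j)) j t
        · rw [g3 h, (pointCount_succ _ _ _ _ _).1 h]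
        · rw [g4 h, (pointCount_succ _ _ _ _ _).2 h])
    ⟨rfl, fun v hv hv' => State.setInt_int_of_ne _ hv' _, by simp [pointCount, IExpr.eval]⟩
  obtain ⟨⟨h1, h2, h3⟩, h4⟩ := hloop
  have hsize : (IExpr.reg Reg.size).eval (u.setInt .count 0 : State Reg Arr) = u.int .size :=
    State.setInt_int_of_ne _ (by simp) _
  rw [hsize] at h3 h4
  simp only [IExpr.eval, Nat.sub_zero, zero_add, IExpr.cost] at h3 h4
  have hrun : (countStep d i).run u = (Prog.seq (.setInt .count (.lit 0))
    (.seq (.loop .scan (.lit 0) (.reg .size) (scanBody d i))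
      (.ite (.intLt (.reg .count) (.reg .least)) (.setInt .least (.reg .count)) .skip))).run u := rfl
  rw [hrun]
  set w := (Prog.loop Reg.scan (.lit 0) (.reg .size) (scanBody d i)).run (u.setInt .count 0) with hw
  have hleast := h2 .least (by simp) (by simp)
  -- Resetting the counter costs `2`; the final comparison and assignment cost at most `6`.
  have hcost : 2 + (w.2 + 6) ≤ (Kt + 20) * (u.int .size + 1) := by nlinarith
  have hrun' : (Prog.seq (.setInt .count (.lit 0))
    (.seq (.loop .scan (.lit 0) (.reg .size) (scanBody d i))
      (.ite (.intLt (.reg .count) (.reg .least)) (.setInt .least (.reg .count)) .skip))).run u =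
      (((Prog.ite (.intLt (.reg .count) (.reg .least)) (.setInt .least (.reg .count)) .skip).run
        w.1).1, 2 + (w.2 + ((Prog.ite (.intLt (.reg .count) (.reg .least))
          (.setInt .least (.reg .count)) .skip).run w.1).2)) := rfl
  rw [hrun', Prog.run]
  by_cases hlt : w.1.int .count < w.1.int .least
  · rw [if_pos (show (Test.intLt (.reg .count) (.reg .least)).Holds w.1 from hlt)]
    refine ⟨h1, fun v g1 g2 g3 => ?_, ?_, ?_⟩
    · rw [← h2 v g1 g2]
      exact State.setInt_int_of_ne _ g3 _
    · rw [h3, hleast] at hlt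
      rw [min_eq_right hlt.le, ← h3]
      exact State.setInt_int_self _ _ _
    · exact le_trans (by simp [Prog.run, Test.cost, IExpr.cost]) hcost
  · rw [if_neg (show ¬ (Test.intLt (.reg .count) (.reg .least)).Holds w.1 from hlt)]
    refine ⟨h1, fun v g1 g2 _ => h2 v g1 g2, ?_, ?_⟩
    · rw [h3, hleast] at hlt
      rw [min_eq_left (not_lt.1 hlt)]
      exact hleast
    · exact le_trans (by simp [Prog.run, Test.cost, IExpr.cost]) hcost

/-- The final `least` is described by the order property of a minimum: below every count and the
initial value, and above each of their common lower bounds. This passes directly through the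
induction. -/
theorem run_countSteps (d : ℕ) (l : List ℕ) : ∃ K : ℕ, ∀ u u' : State Reg Arr,
    u' = ((seqAll (l.map (countStep d))).run u).1 →
    u'.real = u.real ∧
    (∀ v, v ≠ .scan → v ≠ .count → v ≠ .least → u'.int v = u.int v) ∧
    (∀ i ∈ l, u'.int .least ≤ pointCount d u.real (fun j => u.int (.hidx j)) (u.int .size) i) ∧
    u'.int .least ≤ u.int .least ∧
    (∀ x ≤ u.int .least,
      (∀ i ∈ l, x ≤ pointCount d u.real (fun j => u.int (.hidx j)) (u.int .size) i) →
        x ≤ u'.int .least) ∧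
    ((seqAll (l.map (countStep d))).run u).2 ≤ K * (u.int .size + 1) := by
  induction l with
  | nil =>
    refine ⟨1, fun u u' h => ?_⟩
    obtain rfl : u = u' := h.symm
    exact ⟨rfl, fun _ _ _ _ => rfl, by simp, le_rfl, fun x hx _ => hx,
      show 1 ≤ 1 * (u.int .size + 1) by omega⟩
  | cons i l ih =>
    obtain ⟨K, hK⟩ := ih
    obtain ⟨K', hK'⟩ := run_countStep d i
    refine ⟨K' + K, ?_⟩
    rintro u _ rfl
    obtain ⟨h1, h2, h3, h4⟩ := hK' u
    obtain ⟨g1, g2, g3, g4, g5, g6⟩ := hK ((countStep d i).run u).1 _ rfl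
    have hreg : (fun j => ((countStep d i).run u).1.int (.hidx j)) = fun j => u.int (.hidx j) := by
      ext j
      exact h2 _ (by simp) (by simp) (by simp)
    rw [hreg, h1, h2 .size (by simp) (by simp) (by simp)] at g3 g5
    rw [h2 .size (by simp) (by simp) (by simp)] at g6
    rw [h3] at g4 g5
    refine ⟨g1.trans h1, fun v e1 e2 e3 => (g2 v e1 e2 e3).trans (h2 v e1 e2 e3), ?_,
      g4.trans (min_le_left _ _), fun x hx hxl => ?_, ?_⟩
    · intro i' hi'
      rcases List.mem_cons.1 hi' with rfl | hi'
      · exact g4.trans (min_le_right _ _)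
      · exact g3 i' hi'
    · exact g5 x (le_min hx (hxl i (by simp))) fun i' hi' => hxl i' (by simp [hi'])
    · rw [add_mul]
      exact Nat.add_le_add h4 g6

theorem run_treatChoice (d : ℕ) : ∃ K : ℕ, ∀ u u' : State Reg Arr,
    u' = ((treatChoice d).run u).1 →
    u'.real = u.real ∧
    (∀ v, v ≠ .scan → v ≠ .count → v ≠ .least → v ≠ .best → u'.int v = u.int v) ∧
    u.int .best ≤ u'.int .best ∧
    ((pointTest d).Holds u → ∀ x,
      (∀ i < d + 1, x ≤ pointCount d u.real (fun j => u.int (.hidx j)) (u.int .size) i) →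
        x ≤ u'.int .best) ∧
    (u'.int .best = u.int .best ∨ (pointTest d).Holds u ∧ ∀ i < d + 1,
      u'.int .best ≤ pointCount d u.real (fun j => u.int (.hidx j)) (u.int .size) i) ∧
    ((treatChoice d).run u).2 ≤ K * (u.int .size + 1) := by
  obtain ⟨K, hK⟩ := run_countSteps d (List.range (d + 1))
  refine ⟨K + (pointTest d).cost + 20, ?_⟩
  rintro u _ rfl
  rw [treatChoice, Prog.run]
  by_cases ht : (pointTest d).Holds u
  swap
  · rw [if_neg ht]
    refine ⟨rfl, fun _ _ _ _ _ => rfl, le_rfl, fun h => absurd h ht, Or.inl rfl, ?_⟩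
    simp only [Prog.run]
    nlinarith
  rw [if_pos ht]
  obtain ⟨h1, h2, h3, -, h5, h6⟩ := hK (u.setInt .least (u.int .size)) _ rfl
  have hreg : (fun j => (u.setInt .least (u.int .size)).int (.hidx j)) = fun j => u.int (.hidx j) := by
    ext j
    exact State.setInt_int_of_ne _ (by simp) _
  rw [hreg, State.setInt_int_of_ne _ (show Reg.size ≠ .least by simp), State.setInt_real] at h3 h5
  rw [State.setInt_int_of_ne _ (show Reg.size ≠ .least by simp)] at h6
  rw [State.setInt_int_self] at h5
  set w := (seqAll ((List.range (d + 1)).map (countStep d))).run (u.setInt .least (u.int .size))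
    with hw
  have hw2 : ∀ v, v ≠ .scan → v ≠ .count → v ≠ .least → w.1.int v = u.int v := fun v e1 e2 e3 => by
    rw [h2 v e1 e2 e3, State.setInt_int_of_ne _ e3]
  have hbest := hw2 .best (by simp) (by simp) (by simp)
  -- Starting `least` at the number of points is harmless, since no count exceeds it.
  have hx5 : ∀ x, (∀ i < d + 1,
      x ≤ pointCount d u.real (fun j => u.int (.hidx j)) (u.int .size) i) → x ≤ w.1.int .least :=
    fun x hx => h5 x ((hx 0 (by omega)).trans (pointCount_le _ _ _ _ _)) fun i hi =>
      hx i (List.mem_range.1 hi)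
  have hcost : (pointTest d).cost + 1 + (2 + (w.2 + 6)) ≤
      (K + (pointTest d).cost + 20) * (u.int .size + 1) := by nlinarith
  have hrun : (Prog.seq (.setInt .least (.reg .size))
      (.seq (seqAll ((List.range (d + 1)).map (countStep d)))
        (.ite (.intLt (.reg .best) (.reg .least)) (.setInt .best (.reg .least)) .skip))).run u =
      (((Prog.ite (.intLt (.reg .best) (.reg .least)) (.setInt .best (.reg .least)) .skip).run
        w.1).1, 2 + (w.2 + ((Prog.ite (.intLt (.reg .best) (.reg .least))
          (.setInt .best (.reg .least)) .skip).run w.1).2)) := rfl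
  rw [hrun, Prog.run]
  by_cases hlt : w.1.int .best < w.1.int .least
  · rw [if_pos (show (Test.intLt (.reg .best) (.reg .least)).Holds w.1 from hlt)]
    have hb : (w.1.setInt .best (w.1.int .least)).int .best = w.1.int .least :=
      State.setInt_int_self _ _ _
    refine ⟨h1, fun v e1 e2 e3 e4 => ?_, ?_, fun _ x hx => ?_, Or.inr ⟨ht, fun i hi => ?_⟩, ?_⟩
    · rw [← hw2 v e1 e2 e3]
      exact State.setInt_int_of_ne _ e4 _
    · exact (hbest ▸ hlt.le).trans hb.ge
    · exact (hx5 x hx).trans hb.ge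
    · exact hb.le.trans (h3 i (List.mem_range.2 hi))
    · exact le_trans (by simp [Prog.run, Test.cost, IExpr.cost]) hcost
  · rw [if_neg (show ¬ (Test.intLt (.reg .best) (.reg .least)).Holds w.1 from hlt)]
    refine ⟨h1, fun v e1 e2 e3 _ => hw2 v e1 e2 e3, hbest.ge, fun _ x hx => ?_, Or.inl hbest, ?_⟩
    · exact (hx5 x hx).trans (not_lt.1 hlt)
    · exact le_trans (by simp [Prog.run, Test.cost, IExpr.cost]) hcost

/-- The vector in entry `t` of the table. -/
noncomputable def tableVector (d : ℕ) (R : Arr → ℕ → ℝ) (t : ℕ) : EuclideanSpace ℝ (Fin d) :=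
  WithLp.toLp 2 fun c => R (.normal c) t

theorem pointTest_holds (d : ℕ) (u : State Reg Arr) : (pointTest d).Holds u ↔
    PosSpanning fun i : Fin (d + 1) => tableVector d u.real (u.int (.hidx i)) := by
  have hm : ∀ i : Fin (d + 1), (minorExpr d i).eval u =
      signedMinor (fun i : Fin (d + 1) => tableVector d u.real (u.int (.hidx i))) i := by
    intro i
    rw [minorExpr, RExpr.eval, detExpr_eval, signedMinor]
    simp [RExpr.eval, IExpr.eval, tableVector]
  rw [posSpanning_iff_signedMinor]
  simp only [pointTest, Test.Holds, allTests_holds, List.forall_mem_ofFn_iff, RExpr.eval, hm,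
    Int.cast_zero]

/-- The second part of the program computes the maximum over all choices of halfspaces. -/
theorem run_treatChoices (d : ℕ) : ∃ K : ℕ, ∀ (s s' : State Reg Arr), s.int .best = 0 →
    s' = ((chooseLoop .hidx (.reg .numH) (treatChoice d) (d + 1) 0 (.lit 0)).run s).1 →
    (∀ E, (∀ (f : ℕ → ℕ) x, (PosSpanning fun i : Fin (d + 1) => tableVector d s.real (f i)) →
        (∀ i < d + 1, x ≤ pointCount d s.real f (s.int .size) i) → x ≤ E) → s'.int .best ≤ E) ∧
    (∀ (f : ℕ → ℕ) x, (∀ i, i + 1 < d + 1 → f i < f (i + 1)) → (∀ i < d + 1, f i < s.int .numH) →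
      (PosSpanning fun i : Fin (d + 1) => tableVector d s.real (f i)) →
      (∀ i < d + 1, x ≤ pointCount d s.real f (s.int .size) i) → x ≤ s'.int .best) ∧
    ((chooseLoop .hidx (.reg .numH) (treatChoice d) (d + 1) 0 (.lit 0)).run s).2 ≤
      (K * (s.int .size + 1) + 1) * (2 * s.int .numH + 6) ^ (d + 1) := by
  obtain ⟨K, hK⟩ := run_treatChoice d
  refine ⟨K, fun s s' h0 hs' => ?_⟩
  have hx : Function.Injective Reg.hidx := fun i j h => by injection h
  let P : State Reg Arr → Prop := fun u => u.real = s.real ∧ u.int .size = s.int .size ∧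
    u.int .numH = s.int .numH
  have hset : ∀ (u : State Reg Arr) j v, P u → P (u.setInt (.hidx j) v) := fun u j v h => h
  have hhi : ∀ u, P u → (IExpr.reg Reg.numH).eval u = s.int .numH := fun u hu => hu.2.2
  have hbody : ∀ u, P u → P ((treatChoice d).run u).1 ∧
      ∀ j, ((treatChoice d).run u).1.int (.hidx j) = u.int (.hidx j) := fun u hu => by
    obtain ⟨h1, h2, -⟩ := hK u _ rfl
    exact ⟨⟨h1.trans hu.1, (h2 _ (by simp) (by simp) (by simp) (by simp)).trans hu.2.1,
      (h2 _ (by simp) (by simp) (by simp) (by simp)).trans hu.2.2⟩,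
      fun j => h2 _ (by simp) (by simp) (by simp) (by simp)⟩
  have hcost : ∀ u, P u → ((treatChoice d).run u).2 ≤ K * (s.int .size + 1) := fun u hu => by
    have := (hK u _ rfl).2.2.2.2.2
    rwa [hu.2.1] at this
  have hlit : (IExpr.lit 0 : IExpr Reg).cost ≤ 3 := by simp [IExpr.cost]
  refine ⟨fun E hE => ?_, fun f x hf hfN hpos hcount => ?_, ?_⟩
  -- Upper bound: `best ≤ E` is an invariant of all rounds.
  · have := (run_chooseLoop_spec (N := s.int .numH) (hi := .reg .numH) (body := treatChoice d) hx
      le_rfl (fun u => P u ∧ u.int .best ≤ E) (fun _ => 0) 0 (K * (s.int .size + 1))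
      (fun u j v h => h) (fun _ _ _ => rfl) (fun u hu => hhi u hu.1) (fun u hu => ?_) (d + 1) 0 (.lit 0) s hlit
      ⟨⟨rfl, rfl, rfl⟩, by omega⟩).1.2
    · rwa [hs']
    · refine ⟨⟨(hbody u hu.1).1, ?_⟩, (hbody u hu.1).2, le_rfl, hcost u hu.1⟩
      obtain ⟨-, -, -, -, h5, -⟩ := hK u _ rfl
      rcases h5 with h5 | ⟨h5, h6⟩
      · rw [h5]
        exact hu.2
      · rw [pointTest_holds, hu.1.1] at h5
        rw [hu.1.1, hu.1.2.1] at h6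
        exact hE (fun j => u.int (.hidx j)) _ h5 h6
  · rw [hs']
    -- Lower bound: the round for `f` achieves `x ≤ best`, and `best` never decreases.
    refine run_chooseLoop_reach (N := s.int .numH) hx P (fun u => x ≤ u.int .best) hset
      (fun u j v h => h) hhi le_rfl hbody _ hcost
      (fun u _ h => h.trans (hK u _ rfl).2.2.1) hf hfN (fun u hu hreg => ?_)
      (d + 1) 0 (.lit 0) s (zero_add _) hlit ⟨rfl, rfl, rfl⟩ (by simp) (fun _ => Nat.zero_le _)
    obtain ⟨-, -, -, h4, -⟩ := hK u _ rfl
    rw [pointTest_holds, hu.1, hu.2.1] at h4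
    refine h4 ?_ x fun i hi => (hcount i hi).trans (le_of_eq ?_)
    · convert hpos using 3 with i
      exact hreg i i.2
    · classical
      unfold pointCount
      congr 1
      refine Finset.filter_congr fun t _ => forall₂_congr fun j hj => ?_
      rw [InHalfspace, InHalfspace, hreg j hj]
  · exact (run_chooseLoop_spec (N := s.int .numH) (hi := .reg .numH) (body := treatChoice d) hx
      le_rfl P (fun _ => 0) 0 _ hset (fun _ _ _ => rfl) hhi
      (fun u hu => ⟨(hbody u hu).1, (hbody u hu).2, le_rfl, hcost u hu⟩) (d + 1) 0 (.lit 0) s hlit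
      ⟨rfl, rfl, rfl⟩).2.2.2

end EnclosingDepthProgram

/-! ### Correctness and running time of the whole program -/

namespace EnclosingDepthProgram

open RealRAM

variable {d n : ℕ} {S : Finset (EuclideanSpace ℝ (Fin d))} {q : EuclideanSpace ℝ (Fin d)}
  {p : Fin n → EuclideanSpace ℝ (Fin d)}

theorem pointCount_eq_card {R : Arr → ℕ → ℝ} (hp : Function.Injective p)
    (hpS : Set.range p = (S : Set (EuclideanSpace ℝ (Fin d))))
    (hq : ∀ c : Fin d, R (.query c) 0 = q c) (hR : ∀ (i : Fin n) (c : Fin d), R (.data c) i = p i c)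
    (f : ℕ → ℕ) (i : Fin (d + 1)) :
    pointCount d R f n i = (S.filter fun x => ∀ j : Fin (d + 1), j ≠ i →
      0 ≤ inner ℝ (tableVector d R (f j)) (x - q)).card := by
  classical
  have hin : ∀ (j : ℕ) (t : Fin n), InHalfspace d R f j t ↔
      0 ≤ inner ℝ (tableVector d R (f j)) (p t - q) := by
    intro j t
    rw [InHalfspace, Finset.sum_range, PiLp.inner_apply]
    simp [hq, hR, tableVector, mul_comm]
  have hmem : ∀ t, p t ∈ S := fun t => by
    have : p t ∈ (S : Set (EuclideanSpace ℝ (Fin d))) := hpS ▸ ⟨t, rfl⟩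
    exact this
  have hall : ∀ t : Fin n, (∀ j < d + 1, j ≠ (i : ℕ) → InHalfspace d R f j t) ↔
      ∀ j : Fin (d + 1), j ≠ i → 0 ≤ inner ℝ (tableVector d R (f j)) (p t - q) := by
    intro t
    constructor
    · exact fun h j hj => (hin j t).1 (h j j.2 (Fin.val_ne_iff.2 hj))
    · exact fun h j hj hji => (hin j t).2 (h ⟨j, hj⟩ fun h => hji (Fin.ext_iff.1 h))
  unfold pointCount
  refine Finset.card_bij (fun t ht => p ⟨t, Finset.mem_range.1 (Finset.mem_filter.1 ht).1⟩)
    (fun t ht => ?_) (fun t ht t' ht' h => Fin.ext_iff.1 (hp h)) fun x hx => ?_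
  · obtain ⟨h1, h2⟩ := Finset.mem_filter.1 ht
    exact Finset.mem_filter.2 ⟨hmem _, (hall ⟨t, Finset.mem_range.1 h1⟩).1 h2⟩
  · obtain ⟨h1, h2⟩ := Finset.mem_filter.1 hx
    obtain ⟨t, rfl⟩ : x ∈ Set.range p := hpS ▸ h1
    exact ⟨t, Finset.mem_filter.2 ⟨Finset.mem_range.2 t.2, (hall t).2 h2⟩, rfl⟩

/-- Every halfspace that is bounded by a hyperplane through `q` and `d - 1` data points occurs in
the table. -/
theorem exists_tableVector (hd : 1 ≤ d) (hS : InGeneralPosition S q) (hp : Function.Injective p)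
    (hpS : Set.range p = (S : Set (EuclideanSpace ℝ (Fin d)))) {R : Arr → ℕ → ℝ}
    (hq : ∀ c : Fin d, R (.query c) 0 = q c) (hR : ∀ (i : Fin n) (c : Fin d), R (.data c) i = p i c)
    {s : State Reg Arr}
    (hs : ∀ f : ℕ → ℕ, (∀ i, i + 1 < d - 1 → f i < f (i + 1)) → (∀ i < d - 1, f i < n) →
      InTable d s (genCross d (chosenDiff R f)) ∧
      InTable d s fun c => -genCross d (chosenDiff R f) c)
    {a : EuclideanSpace ℝ (Fin d)} (ha : a ≠ 0) {B : Finset (EuclideanSpace ℝ (Fin d))}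
    (hBS : B ⊆ S) (hBc : B.card = d - 1) (haB : ∀ x ∈ B, inner ℝ a (x - q) = 0) :
    ∃ t < s.int .numH, {x | 0 ≤ inner ℝ a (x - q)} =
      {x | 0 ≤ inner ℝ (tableVector d s.real t) (x - q)} := by
  classical
  have hmem : ∀ t, p t ∈ S := fun t => by
    have : p t ∈ (S : Set (EuclideanSpace ℝ (Fin d))) := hpS ▸ ⟨t, rfl⟩
    exact this
  have hIc : (Finset.univ.filter fun t => p t ∈ B).card = d - 1 := by
    rw [← hBc]
    refine Finset.card_bij (fun t _ => p t) (fun t ht => (Finset.mem_filter.1 ht).2)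
      (fun t _ t' _ h => hp h) fun x hx => ?_
    obtain ⟨t, rfl⟩ : x ∈ Set.range p := hpS ▸ hBS hx
    exact ⟨t, by simpa using hx, rfl⟩
  -- The loops visit increasing index sequences only, so the points of `B` are listed in increasing
  -- order of index.
  let g := (Finset.univ.filter fun t => p t ∈ B).orderEmbOfFin hIc
  have hgB : ∀ k, p (g k) ∈ B := fun k =>
    (Finset.mem_filter.1 (Finset.orderEmbOfFin_mem _ hIc k)).2
  let f : ℕ → ℕ := fun k => if h : k < d - 1 then g ⟨k, h⟩ else 0
  have hfg : ∀ k : Fin (d - 1), f k = g k := fun k => dif_pos k.2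
  obtain ⟨h1, h2⟩ := hs f (fun i hi => by
      rw [hfg ⟨i, by omega⟩, hfg ⟨i + 1, hi⟩]
      exact g.strictMono (Fin.mk_lt_mk.2 (Nat.lt_succ_self i)))
    (fun i hi => by rw [hfg ⟨i, hi⟩]; exact (g _).2)
  have hlin : LinearIndependent ℝ fun k => p (g k) - q :=
    hS.linearIndependent (Nat.sub_le d 1) (hp.comp g.injective) fun k => hmem _
  obtain ⟨hw0, hw⟩ := genCross_spec hd hlin (y := chosenDiff R f) fun k j => by
    rw [chosenDiff, hfg, hR, hq]
    rfl
  set w := WithLp.toLp 2 fun c : Fin d => genCross d (chosenDiff R f) c with hwdef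
  obtain ⟨c, hc⟩ := exists_eq_smul_of_orthogonal hlin
    (by rw [finrank_euclideanSpace_fin]; omega) hw0 hw fun k => haB _ (hgB k)
  -- The sign of the factor is unknown, but both opposite normals are stored.
  rcases halfspace_eq_or_eq_neg ha hc q with h | h
  · obtain ⟨t, ht, htw⟩ := h1
    refine ⟨t, ht, ?_⟩
    rw [h, show tableVector d s.real t = w from PiLp.ext fun c => htw c c.2]
  · obtain ⟨t, ht, htw⟩ := h2
    refine ⟨t, ht, ?_⟩
    rw [h, show tableVector d s.real t = -w from PiLp.ext fun c => htw c c.2]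

/-- The halfspaces obtained from optimal enclosing sets are distinct, hence so are their table
indices; sorting these gives a choice that the loops visit, with the sets permuted accordingly. -/
theorem le_of_forall_le_pointCount (hd : 1 ≤ d) (hS : InGeneralPosition S q)
    (hp : Function.Injective p) (hpS : Set.range p = (S : Set (EuclideanSpace ℝ (Fin d))))
    {R : Arr → ℕ → ℝ} (hq : ∀ c : Fin d, R (.query c) 0 = q c)
    (hR : ∀ (i : Fin n) (c : Fin d), R (.data c) i = p i c) {N b : ℕ}
    (htab : ∀ a : EuclideanSpace ℝ (Fin d), a ≠ 0 →
      (∃ B ⊆ S, B.card = d - 1 ∧ ∀ x ∈ B, inner ℝ a (x - q) = 0) →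
      ∃ t < N, {x | 0 ≤ inner ℝ a (x - q)} = {x | 0 ≤ inner ℝ (tableVector d R t) (x - q)})
    (hb : ∀ (f : ℕ → ℕ) x, (∀ i, i + 1 < d + 1 → f i < f (i + 1)) → (∀ i < d + 1, f i < N) →
      (PosSpanning fun i : Fin (d + 1) => tableVector d R (f i)) →
      (∀ i < d + 1, x ≤ pointCount d R f n i) → x ≤ b) :
    enclosingDepth S q ≤ b := by
  rcases Nat.eq_zero_or_pos (enclosingDepth S q) with h0 | h0
  · omega
  obtain ⟨T, hTS, hT⟩ := (enclosingDepth_isGreatest S q).1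
  obtain ⟨a, hap, hac, haT, hai⟩ := hS.exists_halfspaces hd h0 hTS hT
  choose t htN ht using fun j => htab (a j) (hac j).1 (hac j).2
  have htinj : Function.Injective t := fun i j hij => hai (by
    simp only [ht, hij])
  let σ := Tuple.sort t
  have hmono : StrictMono (t ∘ σ) :=
    (Tuple.monotone_sort t).strictMono_of_injective (htinj.comp σ.injective)
  let f : ℕ → ℕ := fun k => if h : k < d + 1 then t (σ ⟨k, h⟩) else 0
  have hf : ∀ k : Fin (d + 1), f k = t (σ k) := fun k => dif_pos k.2
  refine hb f _ (fun i hi => ?_) (fun i hi => ?_) ?_ fun i hi => ?_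
  · rw [hf ⟨i, by omega⟩, hf ⟨i + 1, hi⟩]
    exact hmono (Fin.mk_lt_mk.2 (Nat.lt_succ_self i))
  · rw [hf ⟨i, hi⟩]
    exact htN _
  -- Table normals agree with the `a j` only in their halfspaces, so positive spanning is
  -- transferred through the intersection.
  · rw [← iInter_halfspaces_eq_singleton_iff (by simp) q,
      ← (iInter_halfspaces_eq_singleton_iff (by simp) q).2 hap]
    simp only [hf, ← ht]
    exact σ.surjective.iInter_comp fun j => {x | 0 ≤ inner ℝ (a j) (x - q)}
  · rw [pointCount_eq_card hp hpS hq hR f ⟨i, hi⟩, ← hT.1 (σ ⟨i, hi⟩)]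
    refine Finset.card_le_card fun x hx => Finset.mem_filter.2 ⟨hTS _ hx, fun j hj => ?_⟩
    have h1 : x ∈ {x | 0 ≤ inner ℝ (a (σ j)) (x - q)} :=
      haT (σ ⟨i, hi⟩) (σ j) (σ.injective.ne hj) x hx
    rw [ht, ← hf] at h1
    exact h1

/-- For `n ≥ 1`, `2 * n + 6 ≤ 8 * n` and `2 * N + 6 ≤ 10 * n ^ (d - 1)`. The second phase dominates,
with exponent `1 + (d - 1) * (d + 1)`; the summand `4` pays for the two initial assignments. -/
theorem steps_bound (hd : 1 ≤ d) (K₁ K₂ : ℕ) {n N c₁ c₂ : ℕ} (hn : 1 ≤ n)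
    (hN : N ≤ 2 * n ^ (d - 1)) (h1 : c₁ ≤ (K₁ + 1) * (2 * n + 6) ^ (d - 1))
    (h2 : c₂ ≤ (K₂ * (n + 1) + 1) * (2 * N + 6) ^ (d + 1)) :
    2 + (c₁ + (2 + c₂)) ≤
      (4 + (K₁ + 1) * 8 ^ (d - 1) + (2 * K₂ + 1) * 10 ^ (d + 1)) * n ^ (d ^ 2) := by
  obtain ⟨m, rfl⟩ : ∃ m, d = m + 1 := ⟨d - 1, by omega⟩
  simp only [Nat.add_sub_cancel] at *
  have hM : 1 ≤ n ^ ((m + 1) ^ 2) := Nat.one_le_pow _ _ hn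
  have hm : 1 ≤ n ^ m := Nat.one_le_pow _ _ hn
  have g1 : c₁ ≤ (K₁ + 1) * 8 ^ m * n ^ ((m + 1) ^ 2) := by
    calc c₁ ≤ (K₁ + 1) * (8 * n) ^ m := h1.trans (by gcongr; omega)
      _ = (K₁ + 1) * 8 ^ m * n ^ m := by rw [mul_pow, mul_assoc]
      _ ≤ _ := by gcongr; nlinarith
  have g2 : c₂ ≤ (2 * K₂ + 1) * 10 ^ (m + 1 + 1) * n ^ ((m + 1) ^ 2) := by
    calc c₂ ≤ ((2 * K₂ + 1) * n) * (10 * n ^ m) ^ (m + 1 + 1) := by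
          refine h2.trans (Nat.mul_le_mul ?_ (Nat.pow_le_pow_left (by omega) _))
          nlinarith
      _ = _ := by
          rw [mul_pow, ← pow_mul, show (m + 1) ^ 2 = 1 + m * (m + 1 + 1) by ring, pow_add, pow_one]
          ring
  nlinarith

/-- The program returns the enclosing depth after `O(n ^ (d ^ 2))` steps. -/
theorem program_spec (hd : 1 ≤ d) : ∃ C : ℕ, ∀ (n : ℕ) (S : Finset (EuclideanSpace ℝ (Fin d)))
      (p : Fin n → EuclideanSpace ℝ (Fin d)) (q : EuclideanSpace ℝ (Fin d)) (s : State Reg Arr),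
      Function.Injective p → Set.range p = (S : Set (EuclideanSpace ℝ (Fin d))) →
      InGeneralPosition S q → HoldsInput s p q →
        ((program d).run s).1.int Reg.best = enclosingDepth S q ∧
        (1 ≤ n → ((program d).run s).2 ≤ C * n ^ (d ^ 2)) := by
  obtain ⟨K₁, hK₁⟩ := run_buildTable d
  obtain ⟨K₂, hK₂⟩ := run_treatChoices d
  refine ⟨4 + (K₁ + 1) * 8 ^ (d - 1) + (2 * K₂ + 1) * 10 ^ (d + 1),
    fun n S p q s hp hpS hS ⟨hsize, hq, hR⟩ => ?_⟩
  set s₀ : State Reg Arr := s.setInt .numH 0 with hs₀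
  set r₁ := (chooseLoop .pidx (.reg .size) (addHalfspaces d) (d - 1) 0 (.lit 0)).run s₀ with hr₁
  set s₂ : State Reg Arr := r₁.1.setInt .best 0 with hs₂
  set r₂ := (chooseLoop .hidx (.reg .numH) (treatChoice d) (d + 1) 0 (.lit 0)).run s₂ with hr₂
  have hrun : (program d).run s = (r₂.1, 2 + (r₁.2 + (2 + r₂.2))) := rfl
  have hsize₀ : s₀.int .size = n := (State.setInt_int_of_ne _ (by simp) _).trans hsize
  obtain ⟨h1, h2, h3, h4, h5, h6⟩ := hK₁ s₀ r₁.1 (State.setInt_int_self _ _ _) rfl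
  rw [hsize₀] at h1 h4 h5 h6
  have hsize₂ : s₂.int .size = n := (State.setInt_int_of_ne _ (by simp) _).trans h1
  have hnumH₂ : s₂.int .numH = r₁.1.int .numH := State.setInt_int_of_ne _ (by simp) _
  have hq₂ : ∀ c : Fin d, s₂.real (.query c) 0 = q c := fun c => by
    rw [← hq c]; exact congrFun (h2 c) 0
  have hR₂ : ∀ (i : Fin n) (c : Fin d), s₂.real (.data c) i = p i c := fun i c => by
    rw [← hR i c]; exact congrFun (h3 c) i
  obtain ⟨g1, g2, g3⟩ := hK₂ s₂ r₂.1 (State.setInt_int_self _ _ _) rfl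
  rw [hsize₂] at g1 g2 g3
  rw [hrun]
  -- Any choice passing the test yields enclosing sets, so the output is at most the depth; the
  -- optimal halfspaces occur in the table, so it is at least the depth.
  refine ⟨le_antisymm (g1 _ fun f x hpos hx => ?_) ?_, fun hn => ?_⟩
  · refine le_enclosingDepth hS.1 hpos fun i => ?_
    rw [← pointCount_eq_card hp hpS hq₂ hR₂]
    exact hx i i.2
  · refine le_of_forall_le_pointCount hd hS hp hpS hq₂ hR₂ (fun a ha hB => ?_) g2
    obtain ⟨B, hBS, hBc, hB0⟩ := hB
    rw [hnumH₂]
    exact exists_tableVector hd hS hp hpS hq hR h5 ha hBS hBc hB0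
  · exact steps_bound hd K₁ K₂ hn (hnumH₂ ▸ h4) h6 g3

end EnclosingDepthProgram

open EnclosingDepthProgram in
theorem mainTheorem3 (d : ℕ) (hd : 1 ≤ d) :
    (∀ (S : Finset (EuclideanSpace ℝ (Fin d))) (q : EuclideanSpace ℝ (Fin d)),
      InGeneralPosition S q →
        (candidateHalfspaces S q).ncard = 2 * S.card.choose (d - 1) ∧
        halfspaceMaxMin S q = enclosingDepth S q) ∧
    ∃ C : ℕ, ∀ (n : ℕ) (S : Finset (EuclideanSpace ℝ (Fin d)))
      (p : Fin n → EuclideanSpace ℝ (Fin d)) (q : EuclideanSpace ℝ (Fin d))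
      (s : RealRAM.State Reg Arr),
      Function.Injective p → Set.range p = (S : Set (EuclideanSpace ℝ (Fin d))) →
      InGeneralPosition S q → HoldsInput s p q →
        ((program d).run s).1.int Reg.best = enclosingDepth S q ∧
        (1 ≤ n → ((program d).run s).2 ≤ C * n ^ (d ^ 2)) := by
  exact ⟨fun S q h => ⟨h.ncard_candidateHalfspaces hd, h.halfspaceMaxMin_eq hd⟩, program_spec hd⟩
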